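/- Throughout, rings are commutative with $1$. A $\mathbf Z$-plethory is a monoid in the category of $\mathbf Z$-$\mathbf Z$-birings under the composition product; for a $\mathbf Z$-plethory $P$, a $P$-ring is a ring with an action of $P$, and a $P$-plethory is a $\mathbf Z$-plethory $P'$ with a map of plethories $P\to P'$ (so that $P'$ is in particular a $P$-ring). Let $p$ be a prime number. Let $\Lambda$ be the plethory of symmetric functions in countably many variables $x_1,x_2,\dots$ and $\psi_n=\sum_i x_i^n$. Let $\mathbf Z\langle F\rangle=\mathbf Z[e,F,F\circ F,\dots]$ be the free $\mathbf Z$-plethory on the bialgebra $\mathbf Z[F]$; thus each $F^{\circ n}$ is ring-like ($\Delta^+F^{\circ n}=F^{\circ n}\otimes 1+1\otimes F^{\circ n}$, $\Delta^\times F^{\circ n}=F^{\circ n}\otimes F^{\circ n}$). Let $\Lambda_p\subseteq\Lambda$ be the plethory of $p$-typical symmetric functions, i.e. the sub-plethory of all $f\in\Lambda$ with $p^if\in\mathbf Z[\psi_1,\psi_p,\psi_{p^2},\dots]$ for some $i\ge 0$; it is a $\mathbf Z\langle F\rangle$-plethory through $F^{\circ n}\mapsto\psi_{p^n}$. Let $\mathbf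 F_p[e]$ be the trivial $\mathbf F_p$-plethory (representing the identity functor), and let $\mathbf Z\langle F\rangle\to\mathbf F_p[e]$ be the map of plethories $F^{\circ n}\mapsto e^{p^n}$. Call a $\mathbf Z\langle F\rangle$-ring $R$ a $\mathbf Z\langle F\rangle$-deformation of an $\mathbf F_p[e]$-ring if $R$ is $p$-torsion-free and the action of $\mathbf Z\langle F\rangle$ on $\mathbf F_p\otimes R$ factors through an action of $\mathbf F_p[e]$. The amplification of $\mathbf Z\langle F\rangle$ along $\mathbf F_p[e]$ is the $\mathbf Z\langle F\rangle$-plethory that is universal (initial) among the $\mathbf Z\langle F\rangle$-plethories whose underlying $\mathbf Z\langle F\rangle$-ring is a $\mathbf Z\langle F\rangle$-deformation of an $\mathbf F_p[e]$-ring. **Proposition.** The amplification $P'$ of $\mathbf Z\langle F\rangle$ along $\mathbf F_p[e]$ exists. There is a unique map of $\mathbf Z\langle F\rangle$-rings $\Lambda_p\to P'$ that commutes with the structure maps $\mathbf Z\langle F\rangle\to\Lambda_p$ and $\mathbf Z\langle F\rangle\to P'$, and this map is an isomorphism of $\mathbf Z\langle F\rangle$-plethories. -/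

import Mathlib

open scoped TensorProduct

noncomputable section

universe u

/-! ## Birings -/

/-- The convolution of two points `φ, ψ` of `S` with values in `A`, along a co-operation
`Δ : S → S ⊗ S`, i.e. the binary operation on `Hom_k(S, A)` defined by `Δ`. -/
def conv {k S A : Type*} [CommRing k] [CommRing S] [Algebra k S] [CommRing A] [Algebra k A]
    (Δ : S →ₐ[k] S ⊗[k] S) (φ ψ : S →ₐ[k] A) : S →ₐ[k] A :=
  (Algebra.TensorProduct.productMap φ ψ).comp Δ

section conv
variable {k S A B : Type*} [CommRing k] [CommRing S] [Algebra k S] [CommRing A] [Algebra k A]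
  [CommRing B] [Algebra k B]

theorem comp_conv (g : A →ₐ[k] B) (Δ : S →ₐ[k] S ⊗[k] S) (φ ψ : S →ₐ[k] A) :
    g.comp (conv Δ φ ψ) = conv Δ (g.comp φ) (g.comp ψ) := by
  unfold conv
  rw [← AlgHom.comp_assoc]
  congr 1
  ext <;> simp

theorem ofId_comp_ofId (g : S →ₐ[k] k) (h : A →ₐ[k] B) :
    h.comp ((Algebra.ofId k A).comp g) = (Algebra.ofId k B).comp g := by
  ext; simp [Algebra.ofId_apply]

/-- The first canonical point of `S` in `S ⊗ S`. -/
abbrev pt1 (k S : Type*) [CommRing k] [CommRing S] [Algebra k S] : S →ₐ[k] S ⊗[k] S :=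
  Algebra.TensorProduct.includeLeft

/-- The second canonical point of `S` in `S ⊗ S`. -/
abbrev pt2 (k S : Type*) [CommRing k] [CommRing S] [Algebra k S] : S →ₐ[k] S ⊗[k] S :=
  Algebra.TensorProduct.includeRight

/-- The first canonical point of `S` in `S ⊗ (S ⊗ S)`. -/
abbrev gpt1 (k S : Type*) [CommRing k] [CommRing S] [Algebra k S] :
    S →ₐ[k] S ⊗[k] (S ⊗[k] S) :=
  Algebra.TensorProduct.includeLeft

/-- The second canonical point of `S` in `S ⊗ (S ⊗ S)`. -/
abbrev gpt2 (k S : Type*) [CommRing k] [CommRing S] [Algebra k S] :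
    S →ₐ[k] S ⊗[k] (S ⊗[k] S) :=
  Algebra.TensorProduct.includeRight.comp Algebra.TensorProduct.includeLeft

/-- The third canonical point of `S` in `S ⊗ (S ⊗ S)`. -/
abbrev gpt3 (k S : Type*) [CommRing k] [CommRing S] [Algebra k S] :
    S →ₐ[k] S ⊗[k] (S ⊗[k] S) :=
  Algebra.TensorProduct.includeRight.comp Algebra.TensorProduct.includeRight

end conv

/-- A `k`-`k'`-biring structure on the `k`-ring `S`: a structure of a commutative `k'`-ring object
on `S` in the opposite of the category of `k`-rings. Each identity between co-operations is
written on the canonical points of `S ⊗ S` or `S ⊗ (S ⊗ S)`; for example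
`conv Δ (conv Δ x₁ x₂) x₃ = conv Δ x₁ (conv Δ x₂ x₃)`, for the three canonical points `x₁, x₂, x₃`
of `S ⊗ (S ⊗ S)`, is coassociativity of `Δ`. -/
class Biring (k k' S : Type u) [CommRing k] [CommRing k'] [CommRing S] [Algebra k S] where
  /-- coaddition `Δ⁺` -/
  coadd : S →ₐ[k] S ⊗[k] S
  /-- comultiplication `Δ^×` -/
  comul : S →ₐ[k] S ⊗[k] S
  /-- additive counit `ε⁺` -/
  cozero : S →ₐ[k] k
  /-- antipode `σ` -/
  coneg : S →ₐ[k] S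
  /-- multiplicative counit `ε^×` -/
  coone : S →ₐ[k] k
  /-- co-`k'`-linear structure `β` -/
  colin : k' → (S →ₐ[k] k)
  coadd_assoc : conv coadd (conv coadd (gpt1 k S) (gpt2 k S)) (gpt3 k S) =
    conv coadd (gpt1 k S) (conv coadd (gpt2 k S) (gpt3 k S))
  coadd_comm : conv coadd (pt1 k S) (pt2 k S) = conv coadd (pt2 k S) (pt1 k S)
  coadd_zero : conv coadd ((Algebra.ofId k S).comp cozero) (AlgHom.id k S) = AlgHom.id k S
  coadd_neg : conv coadd coneg (AlgHom.id k S) = (Algebra.ofId k S).comp cozero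
  comul_assoc : conv comul (conv comul (gpt1 k S) (gpt2 k S)) (gpt3 k S) =
    conv comul (gpt1 k S) (conv comul (gpt2 k S) (gpt3 k S))
  comul_comm : conv comul (pt1 k S) (pt2 k S) = conv comul (pt2 k S) (pt1 k S)
  comul_one : conv comul ((Algebra.ofId k S).comp coone) (AlgHom.id k S) = AlgHom.id k S
  codistrib : conv comul (gpt1 k S) (conv coadd (gpt2 k S) (gpt3 k S)) =
    conv coadd (conv comul (gpt1 k S) (gpt2 k S)) (conv comul (gpt1 k S) (gpt3 k S))
  colin_add : ∀ c d : k', colin (c + d) = conv coadd (colin c) (colin d)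
  colin_mul : ∀ c d : k', colin (c * d) = conv comul (colin c) (colin d)
  colin_one : colin 1 = coone

/-- The set `Hom_k(S, A)`, which a `k`-`k'`-biring structure on `S` makes a `k'`-ring. For a
plethory `P` this is the `P`-Witt ring `W_P(A)`. -/
@[ext]
structure WittRing (k k' S A : Type u) [CommRing k] [CommRing S] [Algebra k S]
    [CommRing A] [Algebra k A] where
  /-- the underlying homomorphism -/
  hom : S →ₐ[k] A

namespace WittRing

variable {k k' S A : Type u} [CommRing k] [CommRing k'] [CommRing S] [Algebra k S]
  [CommRing A] [Algebra k A] [Biring k k' S]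

instance : Add (WittRing k k' S A) :=
  ⟨fun x y => ⟨conv (Biring.coadd k') x.hom y.hom⟩⟩
instance : Mul (WittRing k k' S A) :=
  ⟨fun x y => ⟨conv (Biring.comul k') x.hom y.hom⟩⟩
instance : Zero (WittRing k k' S A) := ⟨⟨(Algebra.ofId k A).comp (Biring.cozero k')⟩⟩
instance : One (WittRing k k' S A) := ⟨⟨(Algebra.ofId k A).comp (Biring.coone k')⟩⟩
instance : Neg (WittRing k k' S A) := ⟨fun x => ⟨x.hom.comp (Biring.coneg k')⟩⟩

theorem add_hom (x y : WittRing k k' S A) :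
    (x + y).hom = conv (Biring.coadd k') x.hom y.hom := rfl
theorem mul_hom (x y : WittRing k k' S A) :
    (x * y).hom = conv (Biring.comul k') x.hom y.hom := rfl
theorem zero_hom : (0 : WittRing k k' S A).hom =
    (Algebra.ofId k A).comp (Biring.cozero k') := rfl
theorem one_hom : (1 : WittRing k k' S A).hom =
    (Algebra.ofId k A).comp (Biring.coone k') := rfl
theorem neg_hom (x : WittRing k k' S A) : (-x).hom = x.hom.comp (Biring.coneg k') := rfl

/-- The map from `S ⊗ (S ⊗ S)` given by three points. -/
def tri (x y z : S →ₐ[k] A) : S ⊗[k] (S ⊗[k] S) →ₐ[k] A :=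
  Algebra.TensorProduct.productMap x (Algebra.TensorProduct.productMap y z)

theorem tri1 (x y z : S →ₐ[k] A) : (tri x y z).comp (gpt1 k S) = x := by
  ext; simp [tri]
theorem tri2 (x y z : S →ₐ[k] A) : (tri x y z).comp (gpt2 k S) = y := by
  ext; simp [tri]
theorem tri3 (x y z : S →ₐ[k] A) : (tri x y z).comp (gpt3 k S) = z := by
  ext; simp [tri]


theorem conv_comm_add (x y : S →ₐ[k] A) :
    conv (Biring.coadd k') x y = conv (Biring.coadd k') y x := by
  have h := congrArg (fun g => (Algebra.TensorProduct.productMap x y).comp g)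
    (Biring.coadd_comm (k := k) (k' := k') (S := S))
  simpa only [comp_conv, Algebra.TensorProduct.productMap_left,
    Algebra.TensorProduct.productMap_right] using h

theorem conv_comm_mul (x y : S →ₐ[k] A) :
    conv (Biring.comul k') x y = conv (Biring.comul k') y x := by
  have h := congrArg (fun g => (Algebra.TensorProduct.productMap x y).comp g)
    (Biring.comul_comm (k := k) (k' := k') (S := S))
  simpa only [comp_conv, Algebra.TensorProduct.productMap_left,
    Algebra.TensorProduct.productMap_right] using h

theorem conv_zero (x : S →ₐ[k] A) :
    conv (Biring.coadd k') ((Algebra.ofId k A).comp (Biring.cozero k')) x = x := by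
  have h := congrArg (fun g => x.comp g) (Biring.coadd_zero (k := k) (k' := k') (S := S))
  simpa only [comp_conv, ofId_comp_ofId, AlgHom.comp_id] using h

theorem conv_one (x : S →ₐ[k] A) :
    conv (Biring.comul k') ((Algebra.ofId k A).comp (Biring.coone k')) x = x := by
  have h := congrArg (fun g => x.comp g) (Biring.comul_one (k := k) (k' := k') (S := S))
  simpa only [comp_conv, ofId_comp_ofId, AlgHom.comp_id] using h

theorem conv_distrib (x y z : S →ₐ[k] A) :
    conv (Biring.comul k') x (conv (Biring.coadd k') y z) =
      conv (Biring.coadd k') (conv (Biring.comul k') x y) (conv (Biring.comul k') x z) := by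
  have h := congrArg (fun g => (tri x y z).comp g)
    (Biring.codistrib (k := k) (k' := k') (S := S))
  simpa only [comp_conv, tri1, tri2, tri3] using h

instance : AddCommGroup (WittRing k k' S A) where
  add_assoc x y z := by
    have h := congrArg (fun g => (tri x.hom y.hom z.hom).comp g)
      (Biring.coadd_assoc (k := k) (k' := k') (S := S))
    simp only [comp_conv, tri1, tri2, tri3] at h
    exact WittRing.ext h
  zero_add x := WittRing.ext (conv_zero x.hom)
  add_zero x := WittRing.ext ((conv_comm_add _ _).trans (conv_zero x.hom))
  add_comm x y := WittRing.ext (conv_comm_add _ _)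
  neg_add_cancel x := by
    have h := congrArg (fun g => x.hom.comp g)
      (Biring.coadd_neg (k := k) (k' := k') (S := S))
    simp only [comp_conv, ofId_comp_ofId, AlgHom.comp_id] at h
    exact WittRing.ext h
  nsmul := nsmulRec
  zsmul := zsmulRec

theorem mul_add_aux (x y z : WittRing k k' S A) : x * (y + z) = x * y + x * z :=
  WittRing.ext (conv_distrib _ _ _)

theorem mul_comm_aux (x y : WittRing k k' S A) : x * y = y * x :=
  WittRing.ext (conv_comm_mul _ _)

theorem mul_zero_aux (x : WittRing k k' S A) : x * 0 = 0 := by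
  have h := mul_add_aux x 0 0
  rw [add_zero] at h
  exact left_eq_add.mp h

instance : CommRing (WittRing k k' S A) where
  mul_assoc x y z := by
    have h := congrArg (fun g => (tri x.hom y.hom z.hom).comp g)
      (Biring.comul_assoc (k := k) (k' := k') (S := S))
    simp only [comp_conv, tri1, tri2, tri3] at h
    exact WittRing.ext h
  one_mul x := WittRing.ext (conv_one x.hom)
  mul_one x := WittRing.ext ((conv_comm_mul _ _).trans (conv_one x.hom))
  mul_comm := mul_comm_aux
  left_distrib := mul_add_aux
  right_distrib x y z := by
    rw [mul_comm_aux, mul_add_aux, mul_comm_aux z x, mul_comm_aux z y]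
  mul_zero := mul_zero_aux
  zero_mul x := by rw [mul_comm_aux, mul_zero_aux]
  zsmul := zsmulRec
  neg_add_cancel := neg_add_cancel

instance : Algebra k' (WittRing k k' S A) := RingHom.toAlgebra <|
  RingHom.mk'
    { toFun := fun c => ⟨(Algebra.ofId k A).comp (Biring.colin c)⟩
      map_one' := by rw [Biring.colin_one]; rfl
      map_mul' := fun c d => WittRing.ext (by
        change _ = conv _ _ _
        rw [Biring.colin_mul, comp_conv]) }
    (fun c d => WittRing.ext (by
      change _ = conv _ ((Algebra.ofId k A).comp (Biring.colin c))
        ((Algebra.ofId k A).comp (Biring.colin d))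
      rw [← comp_conv, ← Biring.colin_add]; rfl))

theorem algebraMap_hom (c : k') : (algebraMap k' (WittRing k k' S A) c).hom =
    (Algebra.ofId k A).comp (Biring.colin c) := rfl

/-- Functoriality of `Hom_k(S, A)` in `A`. -/
def map {B : Type u} [CommRing B] [Algebra k B] (g : A →ₐ[k] B) :
    WittRing k k' S A →ₐ[k'] WittRing k k' S B where
  toFun x := ⟨g.comp x.hom⟩
  map_zero' := WittRing.ext (ofId_comp_ofId _ _)
  map_one' := WittRing.ext (ofId_comp_ofId _ _)
  map_add' _ _ := WittRing.ext (comp_conv _ _ _ _)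
  map_mul' _ _ := WittRing.ext (comp_conv _ _ _ _)
  commutes' c := WittRing.ext (ofId_comp_ofId (Biring.colin c) g)

end WittRing

/-! ## Plethories and their actions -/

/-- A `k`-plethory: a monoid in the category of `k`-`k`-birings with the composition product.
By the adjunction between `P ⊙ -` and `Hom_k(P, -)`, a `k`-ring homomorphism `P ⊙ P → P` is a
`k`-ring homomorphism `comp : P → Hom_k(P, P)`, where `comp β` is `α ↦ α ∘ β`. -/
class Plethory (k P : Type u) [CommRing k] [CommRing P] [Algebra k P] extends
    Biring k k P where
  /-- the composition, `comp β` being the map `α ↦ α ∘ β` -/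
  comp : P →ₐ[k] WittRing k k P P
  /-- the unit -/
  unit : P
  /-- the map `∘ : P ⊙ P → P` is compatible with coaddition -/
  comp_coadd : (WittRing.map (conv coadd (pt1 k P) (pt2 k P))).comp comp =
    conv coadd ((WittRing.map (pt1 k P)).comp comp) ((WittRing.map (pt2 k P)).comp comp)
  /-- the map `∘ : P ⊙ P → P` is compatible with comultiplication -/
  comp_comul : (WittRing.map (conv comul (pt1 k P) (pt2 k P))).comp comp =
    conv comul ((WittRing.map (pt1 k P)).comp comp) ((WittRing.map (pt2 k P)).comp comp)
  /-- the map `∘ : P ⊙ P → P` is compatible with the co-`k`-linear structures -/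
  comp_colin : ∀ c : k, (WittRing.map (colin c)).comp comp =
    (Algebra.ofId k (WittRing k k P k)).comp (colin c)
  /-- associativity: `(α ∘ β) ∘ γ = α ∘ (β ∘ γ)` -/
  comp_assoc : ∀ α β γ : P,
    (comp γ).hom ((comp β).hom α) = (comp ((comp γ).hom β)).hom α
  unit_comp : ∀ α : P, (comp α).hom unit = α
  comp_unit : ∀ α : P, (comp unit).hom α = α
  /-- the map `k[e] → P` sending `e` to the unit is a map of birings -/
  coadd_unit : coadd unit = unit ⊗ₜ 1 + 1 ⊗ₜ unit
  comul_unit : comul unit = unit ⊗ₜ unit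
  colin_unit : ∀ c : k, colin c unit = c

/-- The composition `α ∘ β` in a `k`-plethory. -/
def Plethory.circ (k : Type u) {P : Type u} [CommRing k] [CommRing P] [Algebra k P]
    [Plethory k P] (α β : P) : P :=
  (Plethory.comp (k := k) β).hom α

/-- An action of the `k`-plethory `P` on the `k`-ring `R`. A `k`-ring homomorphism `P ⊙ R → R` is
given by adjunction as a `k`-ring homomorphism `coact : R → Hom_k(P, R)`, where `coact r` is
`α ↦ α ∘ r`. -/
structure PAction (k P R : Type u) [CommRing k] [CommRing P] [Algebra k P] [Plethory k P]
    [CommRing R] [Algebra k R] where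
  /-- the action, `coact r` being the map `α ↦ α ∘ r` -/
  coact : R →ₐ[k] WittRing k k P R
  assoc : ∀ (α β : P) (r : R),
    (coact r).hom (Plethory.circ k α β) = (coact ((coact r).hom β)).hom α
  unit_act : ∀ r : R, (coact r).hom (Plethory.unit k) = r

/-- The result `α ∘ r` of an action. -/
def PAction.act {k P R : Type u} [CommRing k] [CommRing P] [Algebra k P] [Plethory k P]
    [CommRing R] [Algebra k R] (a : PAction k P R) (α : P) (r : R) : R :=
  (a.coact r).hom α

/-- A homomorphism of `P`-rings: a homomorphism of `k`-rings that commutes with the actions. -/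
def IsPRingHom {k P R R' : Type u} [CommRing k] [CommRing P] [Algebra k P] [Plethory k P]
    [CommRing R] [Algebra k R] [CommRing R'] [Algebra k R'] (a : PAction k P R)
    (a' : PAction k P R') (φ : R →ₐ[k] R') : Prop :=
  ∀ (α : P) (r : R), φ (a.act α r) = a'.act α (φ r)

/-- A morphism from the `O`-plethory `P` to the `k`-plethory `Q`, over the given map of scalars
`O → k`: a map of birings that is also a map of monoids. -/
structure PlethoryHom (O k P Q : Type u) [CommRing O] [CommRing k] [Algebra O k]
    [CommRing P] [Algebra O P] [Plethory O P]
    [CommRing Q] [Algebra k Q] [Algebra O Q] [IsScalarTower O k Q] [Plethory k Q] where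
  /-- the underlying ring homomorphism -/
  hom : P →ₐ[O] Q
  map_coadd : ∀ α : P, Biring.coadd k (hom α) =
    Algebra.TensorProduct.productMap
      (((pt1 k Q).restrictScalars O).comp hom) (((pt2 k Q).restrictScalars O).comp hom)
      (Biring.coadd O α)
  map_comul : ∀ α : P, Biring.comul k (hom α) =
    Algebra.TensorProduct.productMap
      (((pt1 k Q).restrictScalars O).comp hom) (((pt2 k Q).restrictScalars O).comp hom)
      (Biring.comul O α)
  map_colin : ∀ (c : O) (α : P), Biring.colin (k := k) (algebraMap O k c) (hom α) =
    algebraMap O k (Biring.colin (k := O) c α)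
  map_circ : ∀ α β : P,
    hom (Plethory.circ O α β) = Plethory.circ k (hom α) (hom β)
  map_unit : hom (Plethory.unit O) = Plethory.unit k

/-- A morphism of `O`-plethories. -/
abbrev PlethoryMap (O P P' : Type u) [CommRing O] [CommRing P] [Algebra O P] [Plethory O P]
    [CommRing P'] [Algebra O P'] [Plethory O P'] : Type u :=
  PlethoryHom O O P P'

/-- The homomorphism of `O`-rings underlying a morphism of `O`-plethories. -/
abbrev PlethoryMap.toAlgHom {O P P' : Type u} [CommRing O] [CommRing P] [Algebra O P]
    [Plethory O P] [CommRing P'] [Algebra O P'] [Plethory O P'] (i : PlethoryMap O P P') :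
    P →ₐ[O] P' :=
  PlethoryHom.hom i

section
variable {O P P' : Type u} [CommRing O] [CommRing P] [Algebra O P] [Plethory O P]
  [CommRing P'] [Algebra O P'] [Plethory O P']

theorem PlethoryHom.conv_coadd (i : PlethoryMap O P P') {A : Type u} [CommRing A] [Algebra O A]
    (x y : P' →ₐ[O] A) :
    (conv (Biring.coadd O) x y).comp i.hom =
      conv (Biring.coadd O) (x.comp i.hom) (y.comp i.hom) := by
  ext α
  have h : ((Algebra.TensorProduct.productMap x y).comp (Algebra.TensorProduct.productMap
      (((pt1 O P').restrictScalars O).comp i.hom) (((pt2 O P').restrictScalars O).comp i.hom))) =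
      Algebra.TensorProduct.productMap (x.comp i.hom) (y.comp i.hom) := by
    ext <;> simp
  simp only [conv, AlgHom.comp_apply]
  rw [i.map_coadd, ← h]; rfl

theorem PlethoryHom.conv_comul (i : PlethoryMap O P P') {A : Type u} [CommRing A] [Algebra O A]
    (x y : P' →ₐ[O] A) :
    (conv (Biring.comul O) x y).comp i.hom =
      conv (Biring.comul O) (x.comp i.hom) (y.comp i.hom) := by
  ext α
  have h : ((Algebra.TensorProduct.productMap x y).comp (Algebra.TensorProduct.productMap
      (((pt1 O P').restrictScalars O).comp i.hom) (((pt2 O P').restrictScalars O).comp i.hom))) =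
      Algebra.TensorProduct.productMap (x.comp i.hom) (y.comp i.hom) := by
    ext <;> simp
  simp only [conv, AlgHom.comp_apply]
  rw [i.map_comul, ← h]; rfl

theorem PlethoryHom.res_algebraMap (i : PlethoryMap O P P') (A : Type u) [CommRing A]
    [Algebra O A] (c : O) :
    (⟨(algebraMap O (WittRing O O P' A) c).hom.comp i.hom⟩ : WittRing O O P A) =
      algebraMap O (WittRing O O P A) c := by
  refine WittRing.ext (AlgHom.ext fun α => ?_)
  have h := i.map_colin c α
  simp only [Algebra.algebraMap_self, RingHom.id_apply] at h
  change Algebra.ofId O A (Biring.colin (k := O) c (i.hom α)) =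
    Algebra.ofId O A (Biring.colin (k := O) c α)
  rw [h]

/-- Restriction `Hom_O(P', A) → Hom_O(P, A)` along a map of plethories `P → P'`. -/
def PlethoryHom.res (i : PlethoryMap O P P') (A : Type u) [CommRing A] [Algebra O A] :
    WittRing O O P' A →ₐ[O] WittRing O O P A where
  toFun x := ⟨x.hom.comp i.hom⟩
  map_zero' := by
    have h := i.res_algebraMap A 0
    rwa [map_zero, map_zero] at h
  map_one' := by
    have h := i.res_algebraMap A 1
    rwa [map_one, map_one] at h
  map_add' x y := WittRing.ext (i.conv_coadd _ _)
  map_mul' x y := WittRing.ext (i.conv_comul _ _)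
  commutes' c := i.res_algebraMap A c

/-- The `P`-ring underlying a `P`-plethory `P'`, i.e. a plethory `P'` with a map `i : P → P'`:
the action is `(α, x) ↦ i(α) ∘ x`. -/
def PlethoryHom.action (i : PlethoryMap O P P') : PAction O P P' where
  coact := (i.res P').comp Plethory.comp
  assoc α β r := by
    change (Plethory.comp (k := O) r).hom (i.hom (Plethory.circ O α β)) = _
    rw [i.map_circ]
    exact Plethory.comp_assoc _ _ _
  unit_act r := by
    change (Plethory.comp (k := O) r).hom (i.hom (Plethory.unit O)) = _
    rw [i.map_unit]
    exact Plethory.unit_comp r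
end

/-! ## Amplifications -/

/-- The `O`-module `R` is `m`-torsion-free. -/
def TorsionFreeAt {O : Type*} [CommRing O] (m : Ideal O) (R : Type*) [AddCommGroup R]
    [Module O R] : Prop :=
  ∀ r : R, (∃ n : ℕ, ∀ x ∈ m ^ n, x • r = 0) → r = 0

section
variable {O k P Q : Type u} [CommRing O] [CommRing k] [Algebra O k]
  [CommRing P] [Algebra O P] [Plethory O P]
  [CommRing Q] [Algebra k Q] [Algebra O Q] [IsScalarTower O k Q] [Plethory k Q]

/-- Let `k = O/m` and let `f : P → Q` be a map from an `O`-plethory to a `k`-plethory. A `P`-ring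
`R` is a `P`-deformation of a `Q`-ring if it is `m`-torsion-free and the action of `P` on `k ⊗ R`
factors through an action of `Q` on `k ⊗ R`. The action of `P` on `k ⊗ R` is the one for which
`R → k ⊗ R` is equivariant (on the scalars `k`, the action of `P` comes from that of `Q`). -/
def IsDeformation (f : PlethoryHom O k P Q) {R : Type u} [CommRing R] [Algebra O R]
    (a : PAction O P R) : Prop :=
  TorsionFreeAt (RingHom.ker (algebraMap O k)) R ∧
    ∃ b : PAction k Q (k ⊗[O] R), ∀ (α : P) (r : R),
      b.act (f.hom α) ((1 : k) ⊗ₜ[O] r) = (1 : k) ⊗ₜ[O] a.act α r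

/-- The `P`-plethory `i : P → P'` is the amplification of `P` along `f : P → Q`: it is the initial
`P`-plethory among those whose underlying `P`-ring is a `P`-deformation of a `Q`-ring. -/
structure IsAmplification (f : PlethoryHom O k P Q) {P' : Type u} [CommRing P'] [Algebra O P']
    [Plethory O P'] (i : PlethoryMap O P P') : Prop where
  deformation : IsDeformation f i.action
  initial : ∀ (P'' : Type u) [CommRing P''] [Algebra O P''] [Plethory O P'']
    (j : PlethoryMap O P P''), IsDeformation f j.action →
      ∃! g : PlethoryMap O P' P'', ∀ α : P, g.hom (i.hom α) = j.hom α

end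

/-! ## Plethories with enough ring-like elements -/

/-- Data for a plethory structure on `P` for which there is a family of ring-like elements `ψ m`
(indexed by a monoid `M`, with `ψ m ∘ ψ n = ψ (m + n)`) that detects equality of homomorphisms. -/
structure RingLikeData (M k P : Type u) [AddMonoid M] [CommRing k] [CommRing P]
    [Algebra k P] where
  psi : M → P
  frob : M → (P →ₐ[k] P)
  frob_psi : ∀ m n, frob m (psi n) = psi (m + n)
  coadd : P →ₐ[k] P ⊗[k] P
  coadd_psi : ∀ m, coadd (psi m) = psi m ⊗ₜ 1 + 1 ⊗ₜ psi m
  comul : P →ₐ[k] P ⊗[k] P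
  comul_psi : ∀ m, comul (psi m) = psi m ⊗ₜ psi m
  colin : k → (P →ₐ[k] k)
  colin_psi : ∀ c m, colin c (psi m) = c
  comp : P → (P →ₐ[k] P)
  comp_psi : ∀ β m, comp β (psi m) = frob m β
  ext0 : ∀ f g : P →ₐ[k] k, (∀ m, f (psi m) = g (psi m)) → f = g
  ext1 : ∀ f g : P →ₐ[k] P, (∀ m, f (psi m) = g (psi m)) → f = g
  ext2 : ∀ f g : P →ₐ[k] P ⊗[k] P, (∀ m, f (psi m) = g (psi m)) → f = g
  ext3 : ∀ f g : P →ₐ[k] P ⊗[k] (P ⊗[k] P), (∀ m, f (psi m) = g (psi m)) → f = g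

namespace RingLikeData
variable {M k P : Type u} [AddMonoid M] [CommRing k] [CommRing P] [Algebra k P]
  (D : RingLikeData M k P)

theorem conv_coadd_psi {A : Type*} [CommRing A] [Algebra k A] (x y : P →ₐ[k] A) (m : M) :
    conv D.coadd x y (D.psi m) = x (D.psi m) + y (D.psi m) := by
  simp [conv, D.coadd_psi]

theorem conv_comul_psi {A : Type*} [CommRing A] [Algebra k A] (x y : P →ₐ[k] A) (m : M) :
    conv D.comul x y (D.psi m) = x (D.psi m) * y (D.psi m) := by
  simp [conv, D.comul_psi]

/-- The biring structure. -/
@[reducible] def biring : Biring k k P where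
  coadd := D.coadd
  comul := D.comul
  cozero := D.colin 0
  coneg := D.comp (-D.psi 0)
  coone := D.colin 1
  colin := D.colin
  coadd_assoc := D.ext3 _ _ fun m => by simp only [conv_coadd_psi, add_assoc]
  coadd_comm := D.ext2 _ _ fun m => by simp only [conv_coadd_psi, add_comm]
  coadd_zero := D.ext1 _ _ fun m => by
    simp only [conv_coadd_psi, AlgHom.comp_apply, D.colin_psi, map_zero, zero_add]
  coadd_neg := D.ext1 _ _ fun m => by
    simp only [conv_coadd_psi, AlgHom.comp_apply, D.colin_psi, map_zero, D.comp_psi, map_neg,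
      D.frob_psi, add_zero, AlgHom.id_apply, neg_add_cancel]
  comul_assoc := D.ext3 _ _ fun m => by simp only [conv_comul_psi, mul_assoc]
  comul_comm := D.ext2 _ _ fun m => by simp only [conv_comul_psi, mul_comm]
  comul_one := D.ext1 _ _ fun m => by
    simp only [conv_comul_psi, AlgHom.comp_apply, D.colin_psi, map_one, one_mul]
  codistrib := D.ext3 _ _ fun m => by simp only [conv_comul_psi, conv_coadd_psi, mul_add]
  colin_add c d := D.ext0 _ _ fun m => by simp only [conv_coadd_psi, D.colin_psi]
  colin_mul c d := D.ext0 _ _ fun m => by simp only [conv_comul_psi, D.colin_psi]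
  colin_one := rfl

/-- Evaluation at the ring-like element `ψ m`. -/
def ev (m : M) (A : Type u) [CommRing A] [Algebra k A] :
    letI := D.biring; WittRing k k P A →ₐ[k] A :=
  letI := D.biring
  { toFun := fun x => x.hom (D.psi m)
    map_zero' := by
      change algebraMap k A (D.colin 0 (D.psi m)) = 0
      rw [D.colin_psi, map_zero]
    map_one' := by
      change algebraMap k A (D.colin 1 (D.psi m)) = 1
      rw [D.colin_psi, map_one]
    map_add' := fun x y => D.conv_coadd_psi _ _ _
    map_mul' := fun x y => D.conv_comul_psi _ _ _
    commutes' := fun c => by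
      change algebraMap k A (D.colin c (D.psi m)) = _
      rw [D.colin_psi] }

theorem frob_zero : D.frob 0 = AlgHom.id k P :=
  D.ext1 _ _ fun m => by simp [D.frob_psi]

theorem frob_frob (m n : M) : (D.frob m).comp (D.frob n) = D.frob (m + n) :=
  D.ext1 _ _ fun l => by simp [D.frob_psi, add_assoc]

theorem comp_comp (β γ : P) : (D.comp γ).comp (D.comp β) = D.comp (D.comp γ β) := by
  -- first, `ψ m ∘ -` commutes with `- ∘ γ`
  have h : ∀ m, (D.comp γ).comp (D.frob m) = (D.frob m).comp (D.comp γ) := fun m =>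
    D.ext1 _ _ fun n => by
      simp only [AlgHom.comp_apply, D.frob_psi, D.comp_psi]
      rw [← AlgHom.comp_apply, D.frob_frob]
  refine D.ext1 _ _ fun m => ?_
  simp only [AlgHom.comp_apply, D.comp_psi]
  exact DFunLike.congr_fun (h m) β

/-- The composition as a ring homomorphism `P → Hom_k(P, P)`. -/
def compHom : letI := D.biring; P →ₐ[k] WittRing k k P P :=
  letI := D.biring
  { toFun := fun β => ⟨D.comp β⟩
    map_zero' := WittRing.ext <| D.ext1 _ _ fun m => by
      change D.comp 0 (D.psi m) = D.ev m P 0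
      rw [map_zero, D.comp_psi, map_zero]
    map_one' := WittRing.ext <| D.ext1 _ _ fun m => by
      change D.comp 1 (D.psi m) = D.ev m P 1
      rw [map_one, D.comp_psi, map_one]
    map_add' := fun β γ => WittRing.ext <| D.ext1 _ _ fun m => by
      change D.comp (β + γ) (D.psi m) = conv D.coadd (D.comp β) (D.comp γ) (D.psi m)
      simp only [conv_coadd_psi, D.comp_psi, map_add]
    map_mul' := fun β γ => WittRing.ext <| D.ext1 _ _ fun m => by
      change D.comp (β * γ) (D.psi m) = conv D.comul (D.comp β) (D.comp γ) (D.psi m)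
      simp only [conv_comul_psi, D.comp_psi, map_mul]
    commutes' := fun c => WittRing.ext <| D.ext1 _ _ fun m => by
      change D.comp (algebraMap k P c) (D.psi m) = D.ev m P (algebraMap k _ c)
      rw [AlgHom.commutes, D.comp_psi, AlgHom.commutes] }

/-- The plethory structure. -/
@[reducible] def plethory : Plethory k P where
  toBiring := D.biring
  comp := D.compHom
  unit := D.psi 0
  comp_coadd := by
    let := D.biring
    refine AlgHom.ext fun β => WittRing.ext (D.ext2 _ _ fun m => ?_)
    have key : (D.ev m _).comp ((WittRing.map (conv D.coadd (pt1 k P) (pt2 k P))).comp D.compHom) =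
        (D.ev m _).comp (conv D.coadd ((WittRing.map (pt1 k P)).comp D.compHom)
          ((WittRing.map (pt2 k P)).comp D.compHom)) := by
      refine D.ext2 _ _ fun n => ?_
      rw [comp_conv, conv_coadd_psi]
      change conv D.coadd (pt1 k P) (pt2 k P) (D.comp _ _) =
        pt1 k P (D.comp _ _) + pt2 k P (D.comp _ _)
      rw [D.comp_psi, D.frob_psi, conv_coadd_psi]
    exact DFunLike.congr_fun key β
  comp_comul := by
    let := D.biring
    refine AlgHom.ext fun β => WittRing.ext (D.ext2 _ _ fun m => ?_)
    have key : (D.ev m _).comp ((WittRing.map (conv D.comul (pt1 k P) (pt2 k P))).comp D.compHom) =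
        (D.ev m _).comp (conv D.comul ((WittRing.map (pt1 k P)).comp D.compHom)
          ((WittRing.map (pt2 k P)).comp D.compHom)) := by
      refine D.ext2 _ _ fun n => ?_
      rw [comp_conv, conv_comul_psi]
      change conv D.comul (pt1 k P) (pt2 k P) (D.comp _ _) =
        pt1 k P (D.comp _ _) * pt2 k P (D.comp _ _)
      rw [D.comp_psi, D.frob_psi, conv_comul_psi]
    exact DFunLike.congr_fun key β
  comp_colin c := by
    let := D.biring
    refine AlgHom.ext fun β => WittRing.ext (D.ext0 _ _ fun m => ?_)
    refine DFunLike.congr_fun (f := ((D.ev m _).comp ((WittRing.map _).comp D.compHom)))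
      (g := (D.ev m _).comp ((Algebra.ofId k _).comp _)) (D.ext0 _ _ fun n => ?_) β
    change D.colin c (D.comp _ _) = D.ev m _ (algebraMap k _ (D.colin c (D.psi n)))
    rw [D.comp_psi, D.frob_psi, AlgHom.commutes, D.colin_psi, D.colin_psi]; rfl
  comp_assoc α β γ := DFunLike.congr_fun (D.comp_comp β γ) α
  unit_comp α := by
    change D.comp α (D.psi 0) = α
    rw [D.comp_psi, D.frob_zero]; rfl
  comp_unit α := by
    change D.comp (D.psi 0) α = AlgHom.id k P α
    congr 1
    exact D.ext1 _ _ fun m => by simp [D.comp_psi, D.frob_psi]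
  coadd_unit := D.coadd_psi 0
  comul_unit := D.comul_psi 0
  colin_unit c := D.colin_psi c 0

end RingLikeData

/-! ## The plethories `⟨k⟩ = k[e]` and `k⟨F⟩ = k[e, F, F ∘ F, …]` -/

/-- The trivial `k`-plethory `k[e]`, which represents the identity functor: `e` is ring-like, and
the composition is composition of polynomials. -/
def trivialData (k : Type u) [CommRing k] : RingLikeData PUnit.{u + 1} k (Polynomial k) where
  psi _ := Polynomial.X
  frob _ := AlgHom.id k _
  frob_psi _ _ := rfl
  coadd := Polynomial.aeval (Polynomial.X ⊗ₜ 1 + 1 ⊗ₜ Polynomial.X)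
  coadd_psi _ := Polynomial.aeval_X _
  comul := Polynomial.aeval (Polynomial.X ⊗ₜ Polynomial.X)
  comul_psi _ := Polynomial.aeval_X _
  colin c := Polynomial.aeval c
  colin_psi _ _ := Polynomial.aeval_X _
  comp β := Polynomial.aeval β
  comp_psi _ _ := Polynomial.aeval_X _
  ext0 _ _ h := Polynomial.algHom_ext (h PUnit.unit)
  ext1 _ _ h := Polynomial.algHom_ext (h PUnit.unit)
  ext2 _ _ h := Polynomial.algHom_ext (h PUnit.unit)
  ext3 _ _ h := Polynomial.algHom_ext (h PUnit.unit)

instance (k : Type u) [CommRing k] : Plethory k (Polynomial k) := (trivialData k).plethory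

/-- The polynomial ring `ℤ⟨F⟩ = ℤ[e, F, F ∘ F, …]`; the variable `X n` is `F^{∘n}`. -/
abbrev ZF : Type := MvPolynomial ℕ ℤ

/-- The plethory structure on `ℤ⟨F⟩`, the free `ℤ`-plethory on the bialgebra `ℤ[F]`: the elements
`F^{∘n}` are ring-like and `F^{∘m} ∘ F^{∘n} = F^{∘(m+n)}`. Thus `F^{∘m} ∘ β` is obtained from `β`
by replacing each `F^{∘n}` with `F^{∘(m+n)}`, and `α ∘ β` by replacing each `F^{∘m}` in `α` with
`F^{∘m} ∘ β`. -/
def zfData : RingLikeData ℕ ℤ ZF where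
  psi n := MvPolynomial.X n
  frob m := MvPolynomial.rename (fun n => m + n)
  frob_psi _ _ := MvPolynomial.rename_X _ _
  coadd := MvPolynomial.aeval fun n => MvPolynomial.X n ⊗ₜ 1 + 1 ⊗ₜ MvPolynomial.X n
  coadd_psi _ := MvPolynomial.aeval_X _ _
  comul := MvPolynomial.aeval fun n => MvPolynomial.X n ⊗ₜ MvPolynomial.X n
  comul_psi _ := MvPolynomial.aeval_X _ _
  colin c := MvPolynomial.aeval fun _ => c
  colin_psi _ _ := MvPolynomial.aeval_X _ _
  comp β := MvPolynomial.aeval fun m => MvPolynomial.rename (fun n => m + n) β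
  comp_psi _ _ := MvPolynomial.aeval_X _ _
  ext0 _ _ h := MvPolynomial.algHom_ext h
  ext1 _ _ h := MvPolynomial.algHom_ext h
  ext2 _ _ h := MvPolynomial.algHom_ext h
  ext3 _ _ h := MvPolynomial.algHom_ext h

instance : Plethory ℤ ZF := zfData.plethory

section
variable (p : ℕ) [hp : Fact p.Prime]

/-- The ring homomorphism `ℤ⟨F⟩ → 𝔽_p[e]` sending `F^{∘n}` to `e^{p^n}`. -/
def zfRed : ZF →ₐ[ℤ] Polynomial (ZMod p) :=
  MvPolynomial.aeval fun n => (Polynomial.X : Polynomial (ZMod p)) ^ p ^ n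

theorem zfRed_X (n : ℕ) : zfRed p (MvPolynomial.X n) = Polynomial.X ^ p ^ n :=
  MvPolynomial.aeval_X _ _

theorem zfRed_rename (m : ℕ) (β : ZF) :
    zfRed p (MvPolynomial.rename (fun n => m + n) β) = zfRed p β ^ p ^ m := by
  have key : (zfRed p : ZF →+* Polynomial (ZMod p)).comp
      (MvPolynomial.rename (R := ℤ) (fun n => m + n) : ZF →+* ZF) =
      (iterateFrobenius (Polynomial (ZMod p)) p m).comp (zfRed p : ZF →+* _) := by
    refine MvPolynomial.ringHom_ext' (RingHom.ext_int _ _) fun n => ?_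
    simp only [RingHom.comp_apply, RingHom.coe_coe, MvPolynomial.rename_X, zfRed_X,
      iterateFrobenius_def]
    rw [← pow_mul, pow_add, mul_comm]
  exact DFunLike.congr_fun key β

/-- The natural map from `ℤ⟨F⟩` to the trivial `𝔽_p`-plethory `𝔽_p[e]`, sending `F^{∘n}` to
`e^{p^n}`. -/
def zfToTrivial : PlethoryHom ℤ (ZMod p) ZF (Polynomial (ZMod p)) where
  hom := zfRed p
  map_coadd α := by
    have : CharP (Polynomial (ZMod p) ⊗[ZMod p] Polynomial (ZMod p)) p :=
      charP_of_injective_algebraMap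
        (FaithfulSMul.algebraMap_injective (ZMod p) _) p
    have key : ((trivialData (ZMod p)).coadd.restrictScalars ℤ).comp (zfRed p) =
        (Algebra.TensorProduct.productMap
      (((pt1 (ZMod p) _).restrictScalars ℤ).comp (zfRed p))
      (((pt2 (ZMod p) _).restrictScalars ℤ).comp (zfRed p))).comp zfData.coadd := by
      refine MvPolynomial.algHom_ext fun n => ?_
      have h1 := zfData.coadd_psi n
      have h2 := (trivialData (ZMod p)).coadd_psi PUnit.unit
      simp only [zfData, trivialData] at h1 h2 ⊢
      simp only [AlgHom.comp_apply, AlgHom.restrictScalars_apply, zfRed_X, map_pow, h1, h2,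
        add_pow_char_pow, map_add, Algebra.TensorProduct.productMap_apply_tmul, map_one,
        mul_one, one_mul, Algebra.TensorProduct.includeLeft_apply,
        Algebra.TensorProduct.includeRight_apply]
    exact DFunLike.congr_fun key α
  map_comul α := by
    have key : ((trivialData (ZMod p)).comul.restrictScalars ℤ).comp (zfRed p) =
        (Algebra.TensorProduct.productMap
      (((pt1 (ZMod p) _).restrictScalars ℤ).comp (zfRed p))
      (((pt2 (ZMod p) _).restrictScalars ℤ).comp (zfRed p))).comp zfData.comul := by
      refine MvPolynomial.algHom_ext fun n => ?_
      have h1 := zfData.comul_psi n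
      have h2 := (trivialData (ZMod p)).comul_psi PUnit.unit
      simp only [zfData, trivialData] at h1 h2 ⊢
      simp only [AlgHom.comp_apply, AlgHom.restrictScalars_apply, zfRed_X, map_pow, h1, h2,
        Algebra.TensorProduct.productMap_apply_tmul, Algebra.TensorProduct.includeLeft_apply,
        Algebra.TensorProduct.includeRight_apply, ← mul_pow,
        Algebra.TensorProduct.tmul_mul_tmul, mul_one, one_mul]
    exact DFunLike.congr_fun key α
  map_colin c α := by
    have key : (((trivialData (ZMod p)).colin (algebraMap ℤ (ZMod p) c)).restrictScalars ℤ).comp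
        (zfRed p) = (Algebra.ofId ℤ (ZMod p)).comp (zfData.colin c) := by
      refine MvPolynomial.algHom_ext fun n => ?_
      have h1 := zfData.colin_psi c n
      have h2 := (trivialData (ZMod p)).colin_psi (algebraMap ℤ (ZMod p) c) PUnit.unit
      simp only [zfData, trivialData] at h1 h2 ⊢
      simp only [AlgHom.comp_apply, AlgHom.restrictScalars_apply, zfRed_X, map_pow, h1, h2,
        ZMod.pow_card_pow, Algebra.ofId_apply]
    exact DFunLike.congr_fun key α
  map_circ α β := by
    have key : (zfRed p).comp (zfData.comp β) =
        (((trivialData (ZMod p)).comp (zfRed p β)).restrictScalars ℤ).comp (zfRed p) := by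
      refine MvPolynomial.algHom_ext fun m => ?_
      have h1 := zfData.comp_psi β m
      have h2 := (trivialData (ZMod p)).comp_psi (zfRed p β) PUnit.unit
      simp only [zfData, trivialData] at h1 h2 ⊢
      simp only [AlgHom.comp_apply, AlgHom.restrictScalars_apply, zfRed_X, map_pow, h1, h2,
        zfRed_rename, AlgHom.id_apply]
    exact DFunLike.congr_fun key α
  map_unit := by
    change zfRed p (MvPolynomial.X 0) = Polynomial.X
    rw [zfRed_X, pow_zero, pow_one]

end

/-! ## Symmetric functions -/

/-- Setting the last variable to `0`. -/
def dropVar (N : ℕ) : MvPolynomial (Fin (N + 1)) ℤ →ₐ[ℤ] MvPolynomial (Fin N) ℤ :=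
  MvPolynomial.aeval (Fin.snoc (α := fun _ => MvPolynomial (Fin N) ℤ) MvPolynomial.X 0)

/-- The ring `Λ` of symmetric functions: the inverse limit, in graded rings, of the rings of
symmetric polynomials in `N` variables, i.e. the ring of compatible sequences of symmetric
polynomials of bounded degree. -/
def symmFun : Subring (∀ N : ℕ, MvPolynomial (Fin N) ℤ) where
  carrier := {f | (∀ N, (f N).IsSymmetric) ∧ (∀ N, dropVar N (f (N + 1)) = f N) ∧
    ∃ d : ℕ, ∀ N, (f N).totalDegree ≤ d}
  zero_mem' := ⟨fun N => MvPolynomial.IsSymmetric.zero, fun N => map_zero _, 0, fun N => by simp⟩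
  one_mem' := ⟨fun N => MvPolynomial.IsSymmetric.one, fun N => map_one _, 0, fun N => by simp⟩
  add_mem' := by
    rintro f g ⟨hf1, hf2, d, hf3⟩ ⟨hg1, hg2, e, hg3⟩
    refine ⟨fun N => (hf1 N).add (hg1 N), fun N => ?_, max d e, fun N => ?_⟩
    · simp only [Pi.add_apply, map_add, hf2, hg2]
    · exact (MvPolynomial.totalDegree_add _ _).trans (max_le_max (hf3 N) (hg3 N))
  mul_mem' := by
    rintro f g ⟨hf1, hf2, d, hf3⟩ ⟨hg1, hg2, e, hg3⟩
    refine ⟨fun N => (hf1 N).mul (hg1 N), fun N => ?_, d + e, fun N => ?_⟩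
    · simp only [Pi.mul_apply, map_mul, hf2, hg2]
    · exact (MvPolynomial.totalDegree_mul _ _).trans (add_le_add (hf3 N) (hg3 N))
  neg_mem' := by
    rintro f ⟨hf1, hf2, d, hf3⟩
    refine ⟨fun N => (hf1 N).neg, fun N => ?_, d, fun N => ?_⟩
    · simp only [Pi.neg_apply, map_neg, hf2]
    · simpa using hf3 N

/-- The Adams operation (power sum) `ψ_n = x₁^n + x₂^n + ⋯`, for `n ≥ 1`. -/
def adams (n : ℕ) (hn : n ≠ 0) : symmFun :=
  ⟨fun N => MvPolynomial.psum (Fin N) ℤ n, fun N => MvPolynomial.psum_isSymmetric _ _ n,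
    fun N => by
      simp [dropVar, MvPolynomial.psum, Fin.sum_univ_castSucc, hn], n, fun N => by
      refine MvPolynomial.totalDegree_finsetSum_le fun i _ => ?_
      exact (MvPolynomial.totalDegree_pow _ _).trans (by simp)⟩

section
variable (p : ℕ) [hp : Fact p.Prime]

/-- The element `F^{∘n} = ψ_{p^n}` of `Λ`. -/
def adamsP (n : ℕ) : symmFun := adams (p ^ n) (pow_ne_zero _ hp.out.ne_zero)

/-- The subring `Ψ_p = ℤ[e, F, F ∘ F, …]` of `Λ`. -/
def psiP : Subring symmFun := Subring.closure (Set.range (adamsP p))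

/-- The subring `Λ_p` of `Λ` of the elements `f` such that `p^i f ∈ Ψ_p` for some `i`. -/
def lambdaP : Subring symmFun where
  carrier := {f | ∃ i : ℕ, (p : symmFun) ^ i * f ∈ psiP p}
  zero_mem' := ⟨0, by simp⟩
  one_mem' := ⟨0, by simp⟩
  add_mem' := by
    rintro f g ⟨i, hf⟩ ⟨j, hg⟩
    refine ⟨i + j, ?_⟩
    have h1 := (psiP p).mul_mem (pow_mem (natCast_mem (psiP p) p) j) hf
    have h2 := (psiP p).mul_mem (pow_mem (natCast_mem (psiP p) p) i) hg
    convert (psiP p).add_mem h1 h2 using 1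
    ring
  mul_mem' := by
    rintro f g ⟨i, hf⟩ ⟨j, hg⟩
    refine ⟨i + j, ?_⟩
    convert (psiP p).mul_mem hf hg using 1
    ring
  neg_mem' := by
    rintro f ⟨i, hf⟩
    refine ⟨i, ?_⟩
    convert (psiP p).neg_mem hf using 1
    ring

/-- The ring `Λ_p` of `p`-typical symmetric functions. -/
def LambdaP : Type := lambdaP p

instance : CommRing (LambdaP p) := inferInstanceAs (CommRing (lambdaP p))

namespace LambdaP

/-- The inclusion of `Λ_p` in `Λ`. -/
def incl : LambdaP p →+* symmFun := (lambdaP p).subtype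

/-- The component of an element of `Λ_p` in `N` variables. -/
def lev (N : ℕ) : LambdaP p →ₐ[ℤ] MvPolynomial (Fin N) ℤ :=
  ((Pi.evalRingHom _ N).comp ((symmFun.subtype).comp (incl p))).toIntAlgHom

variable {p}

theorem ext_lev {f g : LambdaP p} (h : ∀ N, lev p N f = lev p N g) : f = g :=
  Subtype.ext (Subtype.ext (funext h))

variable (p)

/-- The element `F^{∘n} = ψ_{p^n}` of `Λ_p`. -/
def psi (n : ℕ) : LambdaP p :=
  ⟨adamsP p n, 0, by
    rw [pow_zero, one_mul]
    exact Subring.subset_closure ⟨n, rfl⟩⟩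

theorem lev_psi (N n : ℕ) : lev p N (psi p n) = ∑ i, MvPolynomial.X i ^ p ^ n := rfl

instance : Module.IsTorsionFree ℤ (LambdaP p) := by
  refine Function.Injective.moduleIsTorsionFree
    (fun f => (fun N => lev p N f : ∀ N, MvPolynomial (Fin N) ℤ)) ?_ ?_
  · exact fun f g h => ext_lev fun N => congrFun h N
  · intro r f
    funext N
    exact map_zsmul (lev p N) r f

/-- Every element of `Λ_p` becomes a polynomial in the `ψ_{p^n}` after multiplication by a power
of `p`. -/
theorem exists_ghost (f : LambdaP p) :
    ∃ (i : ℕ) (G : MvPolynomial ℕ ℤ), (p : LambdaP p) ^ i * f = MvPolynomial.aeval (psi p) G := by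
  obtain ⟨i, hi⟩ := f.2
  have h : ∀ x ∈ psiP p, ∃ G : MvPolynomial ℕ ℤ,
      x = incl p (MvPolynomial.aeval (psi p) G) := by
    intro x hx
    induction hx using Subring.closure_induction with
    | mem x hx =>
      obtain ⟨n, rfl⟩ := hx
      exact ⟨MvPolynomial.X n, by simp; rfl⟩
    | zero => exact ⟨0, by simp⟩
    | one => exact ⟨1, by simp⟩
    | add x y _ _ hx hy =>
      obtain ⟨G, rfl⟩ := hx
      obtain ⟨H, rfl⟩ := hy
      exact ⟨G + H, by simp⟩
    | mul x y _ _ hx hy =>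
      obtain ⟨G, rfl⟩ := hx
      obtain ⟨H, rfl⟩ := hy
      exact ⟨G * H, by simp⟩
    | neg x _ hx =>
      obtain ⟨G, rfl⟩ := hx
      exact ⟨-G, by simp⟩
  obtain ⟨G, hG⟩ := h _ hi
  refine ⟨i, G, ?_⟩
  apply Subtype.ext
  exact hG

end LambdaP
end

/-! ## Divisibility in tensor products -/

/-- The linear form on `M ⊗ M` given by two linear forms on `M`. -/
def formTensor {R M N : Type*} [CommRing R] [AddCommGroup M] [Module R M]
    [AddCommGroup N] [Module R N]
    (c : M →ₗ[R] R) (d : N →ₗ[R] R) : M ⊗[R] N →ₗ[R] R :=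
  (LinearMap.mul' R R).comp (TensorProduct.map c d)

theorem formTensor_tmul {R M N : Type*} [CommRing R] [AddCommGroup M] [Module R M]
    [AddCommGroup N] [Module R N]
    (c : M →ₗ[R] R) (d : N →ₗ[R] R) (x : M) (y : N) : formTensor c d (x ⊗ₜ y) = c x * d y := by
  simp [formTensor]

theorem tensor_dvd {R M J : Type*} [CommRing R] [IsDomain R] [IsPrincipalIdealRing R]
    [AddCommGroup M] [Module R M] (c : J → M →ₗ[R] R) (p : R)
    (hp : Prime p) (hc : ∀ v : M, (∀ j, p ∣ c j v) → ∃ w, v = p • w) (t : M ⊗[R] M)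
    (ht : ∀ j j', p ∣ formTensor (c j) (c j') t) : ∃ t', t = p • t' := by
  obtain ⟨n, v, w, rfl⟩ := TensorProduct.exists_sum_tmul_eq t
  induction n with
  | zero => exact ⟨0, by simp⟩
  | succ n ih =>
    by_cases hw : ∀ i j, p ∣ c j (w i)
    · choose w' hw' using fun i => hc (w i) (hw i)
      refine ⟨∑ i, v i ⊗ₜ w' i, ?_⟩
      rw [Finset.smul_sum]
      exact Finset.sum_congr rfl fun i _ => by rw [hw' i, TensorProduct.tmul_smul]
    · push Not at hw
      obtain ⟨i₀, j₀, h₀⟩ := hw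
      -- a linear relation modulo `p` between the `v i`
      obtain ⟨u, hu⟩ := hc (∑ i, c j₀ (w i) • v i) fun j => by
        have := ht j j₀
        simp only [map_sum, formTensor_tmul] at this
        simpa [mul_comm] using this
      obtain ⟨b, e, hbe⟩ := (hp.irreducible.coprime_iff_not_dvd.mpr h₀)
      rw [Fin.sum_univ_succAbove _ i₀] at hu ⊢
      rw [Fin.sum_univ_succAbove _ i₀] at ht
      have hv : v i₀ = p • (b • v i₀ + e • u) -
          ∑ i, (e * c j₀ (w (i₀.succAbove i))) • v (i₀.succAbove i) := by
        have h1 : v i₀ = (b * p + e * c j₀ (w i₀)) • v i₀ := by rw [hbe, one_smul]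
        have h2 : ∑ i, (e * c j₀ (w (i₀.succAbove i))) • v (i₀.succAbove i) =
            e • (p • u - c j₀ (w i₀) • v i₀) := by
          rw [← hu, add_sub_cancel_left, Finset.smul_sum]
          exact Finset.sum_congr rfl fun i _ => by rw [mul_smul]
        rw [h2]
        conv_lhs => rw [h1]
        module
      have hs : v i₀ ⊗ₜ[R] w i₀ + ∑ i, v (i₀.succAbove i) ⊗ₜ[R] w (i₀.succAbove i) =
          p • ((b • v i₀ + e • u) ⊗ₜ w i₀) + ∑ i, v (i₀.succAbove i) ⊗ₜ[R]
            (w (i₀.succAbove i) - (e * c j₀ (w (i₀.succAbove i))) • w i₀) := by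
        conv_lhs => rw [hv]
        simp only [TensorProduct.sub_tmul, TensorProduct.tmul_sub, TensorProduct.sum_tmul,
          Finset.sum_sub_distrib, TensorProduct.tmul_smul, ← TensorProduct.smul_tmul']
        abel
      rw [hs] at ht ⊢
      obtain ⟨t', ht'⟩ := ih _ _ fun j j' => by
        have := ht j j'
        rw [map_add, map_smul, smul_eq_mul] at this
        exact (dvd_add_right (dvd_mul_right _ _)).mp this
      exact ⟨(b • v i₀ + e • u) ⊗ₜ w i₀ + t', by rw [ht', smul_add]⟩

theorem tensor_zero {R M J : Type*} [CommRing R] [IsDomain R] [AddCommGroup M] [Module R M]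
    [Module.IsTorsionFree R (M ⊗[R] M)]
    (c : J → M →ₗ[R] R) (hc : ∀ v : M, (∀ j, c j v = 0) → v = 0) (t : M ⊗[R] M)
    (ht : ∀ j j', formTensor (c j) (c j') t = 0) : t = 0 := by
  obtain ⟨n, v, w, rfl⟩ := TensorProduct.exists_sum_tmul_eq t
  induction n with
  | zero => simp
  | succ n ih =>
    by_cases hw : ∀ i j, c j (w i) = 0
    · exact Finset.sum_eq_zero fun i _ => by rw [hc _ (hw i), TensorProduct.tmul_zero]
    · push Not at hw
      obtain ⟨i₀, j₀, h₀⟩ := hw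
      have hu := hc (∑ i, c j₀ (w i) • v i) fun j => by
        have := ht j j₀
        simp only [map_sum, formTensor_tmul] at this
        simpa [mul_comm] using this
      rw [Fin.sum_univ_succAbove _ i₀] at hu ⊢
      rw [Fin.sum_univ_succAbove _ i₀] at ht
      have hv := eq_neg_of_add_eq_zero_left hu
      have hs : c j₀ (w i₀) • (v i₀ ⊗ₜ[R] w i₀ +
          ∑ i, v (i₀.succAbove i) ⊗ₜ[R] w (i₀.succAbove i)) =
          ∑ i, v (i₀.succAbove i) ⊗ₜ[R]
            (c j₀ (w i₀) • w (i₀.succAbove i) - c j₀ (w (i₀.succAbove i)) • w i₀) := by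
        rw [smul_add, TensorProduct.smul_tmul', hv, Finset.smul_sum]
        simp only [TensorProduct.tmul_sub, TensorProduct.sum_tmul, TensorProduct.neg_tmul,
          Finset.sum_sub_distrib, TensorProduct.tmul_smul, ← TensorProduct.smul_tmul']
        abel
      have h := ih _ _ fun j j' => by
        rw [← hs, map_smul, ht j j', smul_zero]
      rw [← hs] at h
      exact (smul_eq_zero.mp h).resolve_left h₀

/-! ## The plethory structure on `Λ_p` -/

theorem aeval_dvd_sub {B : Type*} [CommRing B] [Algebra ℤ B] (d : B) (b b' : ℕ → B)
    (h : ∀ n, d ∣ b n - b' n) (G : MvPolynomial ℕ ℤ) :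
    d ∣ MvPolynomial.aeval b G - MvPolynomial.aeval b' G := by
  induction G using MvPolynomial.induction_on with
  | C a => simp
  | add G H hG hH =>
    rw [map_add, map_add, add_sub_add_comm]
    exact dvd_add hG hH
  | mul_X G n hG =>
    rw [map_mul, map_mul, MvPolynomial.aeval_X, MvPolynomial.aeval_X]
    exact dvd_mul_sub_mul hG (h n)

/-- Modulo `D > 0`, every integral polynomial is a sum of monomials with coefficient `1`. -/
theorem exists_monomials (N D : ℕ) (hD : 0 < D) (r : MvPolynomial (Fin N) ℤ) :
    ∃ l : List (Fin N →₀ ℕ), (D : MvPolynomial (Fin N) ℤ) ∣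
      r - (l.map fun m => MvPolynomial.monomial m (1 : ℤ)).sum := by
  induction r using MvPolynomial.induction_on' with
  | monomial m a =>
    refine ⟨List.replicate (a % D).toNat m, MvPolynomial.monomial m (a / D), ?_⟩
    have h0 : 0 ≤ a % (D : ℤ) := Int.emod_nonneg _ (by positivity)
    have h1 : ((a % (D : ℤ)).toNat : ℤ) = a - D * (a / D) := by
      rw [Int.toNat_of_nonneg h0, Int.emod_def]
    have h2 : (D : MvPolynomial (Fin N) ℤ) = MvPolynomial.C (D : ℤ) := by simp
    rw [List.map_replicate, List.sum_replicate, h2, MvPolynomial.C_mul_monomial,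
      ← map_nsmul, nsmul_eq_mul, mul_one, h1, ← map_sub, sub_sub_cancel]
  | add r s hr hs =>
    obtain ⟨l, hl⟩ := hr
    obtain ⟨l', hl'⟩ := hs
    refine ⟨l ++ l', ?_⟩
    rw [List.map_append, List.sum_append, add_sub_add_comm]
    exact dvd_add hl hl'

/-- A ring homomorphism as a `ℤ`-algebra homomorphism. -/
def intAlgHom {A B : Type*} [CommRing A] [CommRing B] [Algebra ℤ A] [Algebra ℤ B] (f : A →+* B) :
    A →ₐ[ℤ] B :=
  { f with commutes' := fun n => by simp }

namespace LambdaP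
variable (p : ℕ) [hp : Fact p.Prime]

/-- Evaluation of symmetric functions at a finite alphabet `x₁, …, x_K`, i.e. the map
`f ↦ f(x₁, …, x_K, 0, 0, …)`. -/
def evalAt {B : Type*} [CommRing B] [Algebra ℤ B] {K : ℕ} (x : Fin K → B) : LambdaP p →ₐ[ℤ] B :=
  (MvPolynomial.aeval x).comp (lev p K)

theorem evalAt_psi {B : Type*} [CommRing B] [Algebra ℤ B] {K : ℕ} (x : Fin K → B) (n : ℕ) :
    evalAt p x (psi p n) = ∑ i, x i ^ p ^ n := by
  simp [evalAt, lev_psi]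

theorem lev_dvd (i N : ℕ) (G : MvPolynomial ℕ ℤ) (f : LambdaP p)
    (h : (p : LambdaP p) ^ i * f = MvPolynomial.aeval (psi p) G) (r : MvPolynomial (Fin N) ℤ) :
    (p : MvPolynomial (Fin N) ℤ) ^ i ∣
      MvPolynomial.aeval (fun n => MvPolynomial.expand (p ^ n) r) G := by
  obtain ⟨l, hl⟩ := exists_monomials N (p ^ i) (pow_pos hp.out.pos i) r
  rw [Nat.cast_pow] at hl
  set s := (l.map fun m => MvPolynomial.monomial m (1 : ℤ)).sum with hs
  have h1 := aeval_dvd_sub ((p : MvPolynomial (Fin N) ℤ) ^ i)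
    (fun n => MvPolynomial.expand (p ^ n) r) (fun n => MvPolynomial.expand (p ^ n) s)
    (fun n => by
      obtain ⟨c, hc⟩ := hl
      exact ⟨MvPolynomial.expand (p ^ n) c, by rw [← map_sub, hc]; simp⟩) G
  have h2 : MvPolynomial.aeval (fun n => MvPolynomial.expand (p ^ n) s) G =
      (p : MvPolynomial (Fin N) ℤ) ^ i *
        evalAt p (fun j : Fin l.length => MvPolynomial.monomial (l.get j) (1 : ℤ)) f := by
    have h3 := congrArg
      (evalAt p (fun j : Fin l.length => MvPolynomial.monomial (l.get j) (1 : ℤ))) h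
    rw [map_mul, map_pow, map_natCast, MvPolynomial.comp_aeval_apply] at h3
    rw [h3]
    congr 2
    funext n
    have h4 : s = ∑ j : Fin l.length, MvPolynomial.monomial (l.get j) (1 : ℤ) := by
      rw [hs, ← List.sum_ofFn]
      congr 1
      exact List.ext_get (by simp) (by simp)
    rw [evalAt_psi, h4, map_sum]
    exact Finset.sum_congr rfl fun j _ => by
      rw [MvPolynomial.expand_monomial, MvPolynomial.monomial_pow, one_pow]
  rw [h2] at h1
  exact (dvd_iff_dvd_of_dvd_sub h1).mpr (dvd_mul_right _ _)

theorem eq_zero_of_dvd {σ : Type*} (z : MvPolynomial σ ℤ)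
    (h : ∀ i : ℕ, (p : MvPolynomial σ ℤ) ^ i ∣ z) : z = 0 := by
  ext m
  rw [MvPolynomial.coeff_zero]
  by_contra hne
  have h1 : ∀ i : ℕ, (p : ℤ) ^ i ∣ z.coeff m := by
    intro i
    obtain ⟨c, hc⟩ := h i
    refine ⟨c.coeff m, ?_⟩
    have : (p : MvPolynomial σ ℤ) ^ i = MvPolynomial.C ((p : ℤ) ^ i) := by simp
    rw [hc, this, MvPolynomial.coeff_C_mul]
  exact (FiniteMultiplicity.not_iff_forall.mpr h1)
    (Int.finiteMultiplicity_iff.mpr ⟨by simpa using hp.out.ne_one, hne⟩)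

theorem lev_zero (N : ℕ) (G : MvPolynomial ℕ ℤ) (h : MvPolynomial.aeval (psi p) G = 0)
    (r : MvPolynomial (Fin N) ℤ) :
    MvPolynomial.aeval (fun n => MvPolynomial.expand (p ^ n) r) G = 0 :=
  eq_zero_of_dvd p _ fun i => lev_dvd p i N G 0 (by rw [mul_zero, h]) r

/-- `Λ_p` is `p`-saturated in the product of the polynomial rings. -/
theorem exists_of_lev_dvd (i : ℕ) (x : LambdaP p)
    (h : ∀ N, (p : MvPolynomial (Fin N) ℤ) ^ i ∣ lev p N x) :
    ∃ y : LambdaP p, (p : LambdaP p) ^ i * y = x := by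
  choose y hy using h
  have hq : ∀ N, (p : MvPolynomial (Fin N) ℤ) ^ i ≠ 0 := fun N =>
    pow_ne_zero _ (Nat.cast_ne_zero.mpr hp.out.ne_zero)
  have hx := (incl p x).2
  have hy' : ∀ N, (incl p x).1 N = (p : MvPolynomial (Fin N) ℤ) ^ i * y N := hy
  obtain ⟨h1, h2, d, h3⟩ := hx
  let y0 : symmFun := ⟨y, fun N e => by
      have := h1 N e
      rw [hy', map_mul, map_pow, map_natCast] at this
      exact mul_left_cancel₀ (hq N) this, fun N => by
      have := h2 N
      rw [hy', hy', map_mul, map_pow, map_natCast] at this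
      exact mul_left_cancel₀ (hq N) this, d, fun N => by
      have := h3 N
      rw [hy'] at this
      by_cases h0 : y N = 0
      · rw [h0]; simp
      · rw [MvPolynomial.totalDegree_mul_of_isDomain (hq N) h0] at this
        exact (Nat.le_add_left _ _).trans this⟩
  have hy0 : (p : symmFun) ^ i * y0 = incl p x := by
    apply Subtype.ext
    funext N
    rw [hy' N]
    simp [y0]
  obtain ⟨j, hj⟩ := x.2
  refine ⟨⟨y0, j + i, ?_⟩, Subtype.ext hy0⟩
  rw [pow_add, mul_assoc, hy0]
  exact hj

/-- `p` is a nonzerodivisor on a torsion-free ring. -/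
theorem p_cancel {B : Type*} [CommRing B] [Algebra ℤ B] [Module.IsTorsionFree ℤ B] (i : ℕ)
    {x y : B} (h : (p : B) ^ i * x = (p : B) ^ i * y) : x = y := by
  have h1 : ∀ z : B, ((p : ℤ) ^ i) • z = (p : B) ^ i * z := fun z => by
    rw [zsmul_eq_mul]; simp
  rw [← h1, ← h1] at h
  have h2 : ((p : ℤ) ^ i) • (x - y) = 0 := by rw [smul_sub, h, sub_self]
  have h3 := (smul_eq_zero.mp h2).resolve_left
    (pow_ne_zero _ (by exact_mod_cast hp.out.ne_zero))
  exact sub_eq_zero.mp h3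

theorem hom_ext {B : Type*} [CommRing B] [Algebra ℤ B] [Module.IsTorsionFree ℤ B]
    (φ χ : LambdaP p →ₐ[ℤ] B) (h : ∀ n, φ (psi p n) = χ (psi p n)) : φ = χ := by
  refine AlgHom.ext fun f => ?_
  obtain ⟨i, G, hG⟩ := exists_ghost p f
  have key : φ.comp (MvPolynomial.aeval (psi p)) = χ.comp (MvPolynomial.aeval (psi p)) :=
    MvPolynomial.algHom_ext fun n => by simpa using h n
  have h1 := DFunLike.congr_fun key G
  rw [AlgHom.comp_apply, AlgHom.comp_apply, ← hG] at h1
  simp only [map_mul, map_pow, map_natCast] at h1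
  exact p_cancel p i h1

section lift
variable {B : Type*} [CommRing B] [Algebra ℤ B] [Module.IsTorsionFree ℤ B] (b : ℕ → B)

theorem exists_lift
    (H : ∀ (i : ℕ) (G : MvPolynomial ℕ ℤ) (f : LambdaP p),
      (p : LambdaP p) ^ i * f = MvPolynomial.aeval (psi p) G →
        (p : B) ^ i ∣ MvPolynomial.aeval b G)
    (H0 : ∀ G : MvPolynomial ℕ ℤ, MvPolynomial.aeval (psi p) G = 0 →
      MvPolynomial.aeval b G = 0) :
    ∃ φ : LambdaP p →ₐ[ℤ] B, ∀ n, φ (psi p n) = b n := by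
  have h : ∀ f : LambdaP p, ∃ x : B, ∀ (i : ℕ) (G : MvPolynomial ℕ ℤ),
      (p : LambdaP p) ^ i * f = MvPolynomial.aeval (psi p) G →
        (p : B) ^ i * x = MvPolynomial.aeval b G := by
    intro f
    obtain ⟨i, G, hG⟩ := exists_ghost p f
    obtain ⟨x, hx⟩ := H i G f hG
    refine ⟨x, fun j G' hG' => p_cancel p i ?_⟩
    have h1 := H0 ((p : MvPolynomial ℕ ℤ) ^ j * G - (p : MvPolynomial ℕ ℤ) ^ i * G') (by
      simp only [map_sub, map_mul, map_pow, map_natCast, ← hG, ← hG']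
      ring)
    simp only [map_sub, map_mul, map_pow, map_natCast, hx] at h1
    linear_combination h1
  choose φ hφ using h
  have hC : ∀ (a : ℕ → B) (n : ℤ), MvPolynomial.aeval a (MvPolynomial.C n) = (n : B) := by
    intro a n; simp
  refine ⟨intAlgHom
    { toFun := φ
      map_one' := by
        have := hφ 1 0 1 (by simp)
        simpa using this
      map_zero' := by
        have := hφ 0 0 0 (by simp)
        simpa using this
      map_add' := fun f g => by
        obtain ⟨i, G, hG⟩ := exists_ghost p f
        obtain ⟨j, G', hG'⟩ := exists_ghost p g
        have h1 := hφ f i G hG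
        have h2 := hφ g j G' hG'
        have h3 := hφ (f + g) (i + j)
          ((p : MvPolynomial ℕ ℤ) ^ j * G + (p : MvPolynomial ℕ ℤ) ^ i * G') (by
            simp only [map_add, map_mul, map_pow, map_natCast, ← hG, ← hG']; ring)
        simp only [map_add, map_mul, map_pow, map_natCast, ← h1, ← h2] at h3
        refine p_cancel p (i + j) (h3.trans ?_)
        ring
      map_mul' := fun f g => by
        obtain ⟨i, G, hG⟩ := exists_ghost p f
        obtain ⟨j, G', hG'⟩ := exists_ghost p g
        have h1 := hφ f i G hG
        have h2 := hφ g j G' hG'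
        have h3 := hφ (f * g) (i + j) (G * G') (by
            simp only [map_mul, ← hG, ← hG']; ring)
        simp only [map_mul, ← h1, ← h2] at h3
        refine p_cancel p (i + j) (h3.trans ?_)
        ring }, fun n => ?_⟩
  have h1 := hφ (psi p n) 0 (MvPolynomial.X n) (by simp)
  have h2 : φ (psi p n) = b n := by simpa using h1
  exact h2

end lift

theorem exists_colin (c : ℤ) : ∃ φ : LambdaP p →ₐ[ℤ] ℤ, ∀ n, φ (psi p n) = c := by
  have h : ∀ G : MvPolynomial ℕ ℤ, MvPolynomial.aeval (fun _ => c) G =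
      MvPolynomial.constantCoeff (σ := Fin 0) (MvPolynomial.aeval
        (fun n => MvPolynomial.expand (p ^ n) (MvPolynomial.C c)) G) := by
    intro G
    induction G using MvPolynomial.induction_on with
    | C a => simp
    | add G G' hG hG' => simp only [map_add, hG, hG']
    | mul_X G n hG => simp only [map_mul, hG]; simp
  refine exists_lift p (fun _ => c) (fun i G f hf => ?_) (fun G hG => ?_)
  · obtain ⟨x, hx⟩ := lev_dvd p i 0 G f hf (MvPolynomial.C c)
    exact ⟨MvPolynomial.constantCoeff x, by rw [h, hx]; simp⟩
  · rw [h, lev_zero p 0 G hG, map_zero]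

/-- The ring endomorphism `f(x₁, x₂, …) ↦ f(x₁^q, x₂^q, …)` of `Λ`, where `q = p^m`. -/
def frobSymm (m : ℕ) : symmFun →+* symmFun where
  toFun f := ⟨fun N => MvPolynomial.expand (p ^ m) (f.1 N),
    fun N e => by
      have h : ∀ g : MvPolynomial (Fin N) ℤ, MvPolynomial.rename e (MvPolynomial.expand (p ^ m) g) =
          MvPolynomial.expand (p ^ m) (MvPolynomial.rename e g) := fun g => by
        refine DFunLike.congr_fun (f := (MvPolynomial.rename e).comp (MvPolynomial.expand (p ^ m)))
          (g := (MvPolynomial.expand (p ^ m)).comp (MvPolynomial.rename e)) ?_ g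
        exact MvPolynomial.algHom_ext fun i => by simp
      rw [h, f.2.1 N e],
    fun N => by
      have h : ∀ g, dropVar N (MvPolynomial.expand (p ^ m) g) =
          MvPolynomial.expand (p ^ m) (dropVar N g) := fun g => by
        refine DFunLike.congr_fun (f := (dropVar N).comp (MvPolynomial.expand (p ^ m)))
          (g := (MvPolynomial.expand (p ^ m)).comp (dropVar N)) ?_ g
        refine MvPolynomial.algHom_ext fun i => ?_
        induction i using Fin.lastCases with
        | last => simp [dropVar, hp.out.ne_zero]
        | cast i => simp [dropVar]
      rw [h, f.2.2.1 N],
    by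
      obtain ⟨d, hd⟩ := f.2.2.2
      refine ⟨p ^ m * d, fun N => ?_⟩
      simp only [MvPolynomial.totalDegree_expand]
      rw [mul_comm]
      exact Nat.mul_le_mul_left _ (hd N)⟩
  map_one' := Subtype.ext (funext fun N => map_one _)
  map_zero' := Subtype.ext (funext fun N => map_zero _)
  map_add' f g := Subtype.ext (funext fun N => map_add _ _ _)
  map_mul' f g := Subtype.ext (funext fun N => map_mul _ _ _)

theorem frobSymm_adamsP (m n : ℕ) : frobSymm p m (adamsP p n) = adamsP p (m + n) := by
  refine Subtype.ext (funext fun N => ?_)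
  change MvPolynomial.expand (p ^ m) (MvPolynomial.psum (Fin N) ℤ (p ^ n)) =
    MvPolynomial.psum (Fin N) ℤ (p ^ (m + n))
  simp [MvPolynomial.psum, pow_add, pow_mul]

/-- The ring endomorphism `f ↦ F^{∘m} ∘ f` of `Λ_p`, namely
`f(x₁, x₂, …) ↦ f(x₁^q, x₂^q, …)` with `q = p^m`. -/
def frob (m : ℕ) : LambdaP p →ₐ[ℤ] LambdaP p :=
  intAlgHom (RingHom.codRestrict ((frobSymm p m).comp (incl p)) (lambdaP p) (fun f => by
    obtain ⟨i, hi⟩ := f.2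
    have h : psiP p ≤ (psiP p).comap (frobSymm p m) := by
      refine Subring.closure_le.mpr ?_
      rintro _ ⟨n, rfl⟩
      change frobSymm p m _ ∈ psiP p
      rw [frobSymm_adamsP]
      exact Subring.subset_closure ⟨_, rfl⟩
    have h1 := h hi
    refine ⟨i, ?_⟩
    change frobSymm p m (_ * _) ∈ psiP p at h1
    rw [map_mul, map_pow, map_natCast] at h1
    exact h1) : LambdaP p →+* LambdaP p)

theorem frob_psi (m n : ℕ) : frob p m (psi p n) = psi p (m + n) :=
  Subtype.ext (frobSymm_adamsP p m n)

theorem lev_frob (m N : ℕ) (f : LambdaP p) :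
    lev p N (frob p m f) = MvPolynomial.expand (p ^ m) (lev p N f) := rfl

theorem exists_comp (g : LambdaP p) :
    ∃ φ : LambdaP p →ₐ[ℤ] LambdaP p, ∀ n, φ (psi p n) = frob p n g := by
  have h : ∀ (N : ℕ) (G : MvPolynomial ℕ ℤ),
      lev p N (MvPolynomial.aeval (fun n => frob p n g) G) =
        MvPolynomial.aeval (fun n => MvPolynomial.expand (p ^ n) (lev p N g)) G := fun N G => by
    rw [MvPolynomial.comp_aeval_apply]; rfl
  refine exists_lift p _ (fun i G f hf => ?_) (fun G hG => ?_)
  · obtain ⟨y, hy⟩ := exists_of_lev_dvd p i (MvPolynomial.aeval (fun n => frob p n g) G)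
      (fun N => by rw [h]; exact lev_dvd p i N G f hf _)
    exact ⟨y, hy.symm⟩
  · refine ext_lev fun N => ?_
    rw [h, lev_zero p N G hG, map_zero]

theorem torsionFree_tensor {R M N : Type*} [CommRing R] [IsDedekindDomain R] [AddCommGroup M]
    [Module R M] [AddCommGroup N] [Module R N] [Module.IsTorsionFree R M]
    [Module.IsTorsionFree R N] : Module.IsTorsionFree R (M ⊗[R] N) := inferInstance

theorem torsionFree_int (M : Type*) [AddCommGroup M] (m m' : Module ℤ M)
    (h : @Module.IsTorsionFree ℤ M _ _ m) : @Module.IsTorsionFree ℤ M _ _ m' := by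
  have : m = m' := Subsingleton.elim _ _
  rwa [← this]

instance (N M : ℕ) :
    Module.IsTorsionFree ℤ (MvPolynomial (Fin N) ℤ ⊗[ℤ] MvPolynomial (Fin M) ℤ) :=
  torsionFree_int _ _ _ torsionFree_tensor

instance : Module.IsTorsionFree ℤ (LambdaP p ⊗[ℤ] LambdaP p) :=
  torsionFree_int _ _ _ (torsionFree_tensor (R := ℤ) (M := LambdaP p) (N := LambdaP p))

/-- The map `Λ_p ⊗ Λ_p → ℤ[x₁, …, x_N] ⊗ ℤ[y₁, …, y_M]`. -/
def lev2 (N M : ℕ) : LambdaP p ⊗[ℤ] LambdaP p →ₐ[ℤ]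
    MvPolynomial (Fin N) ℤ ⊗[ℤ] MvPolynomial (Fin M) ℤ :=
  Algebra.TensorProduct.map (lev p N) (lev p M)

/-- The coefficients of an element of `Λ_p`. -/
def coeffForm (j : Σ N : ℕ, Fin N →₀ ℕ) : LambdaP p →ₗ[ℤ] ℤ :=
  (MvPolynomial.lcoeff ℤ j.2).comp (lev p j.1).toLinearMap

theorem coeffForm_apply (j : Σ N : ℕ, Fin N →₀ ℕ) (f : LambdaP p) :
    coeffForm p j f = (lev p j.1 f).coeff j.2 := rfl

theorem formTensor_lev2 (j j' : Σ N : ℕ, Fin N →₀ ℕ) (t : LambdaP p ⊗[ℤ] LambdaP p) :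
    formTensor (coeffForm p j) (coeffForm p j') t =
      formTensor (MvPolynomial.lcoeff ℤ j.2) (MvPolynomial.lcoeff ℤ j'.2)
        (lev2 p j.1 j'.1 t) := by
  induction t with
  | zero => simp
  | tmul x y => simp [lev2, formTensor_tmul, coeffForm_apply]
  | add x y hx hy => rw [map_add, map_add, map_add, hx, hy]

theorem eq_zero_of_lev2 (t : LambdaP p ⊗[ℤ] LambdaP p) (h : ∀ N M, lev2 p N M t = 0) :
    t = 0 := by
  refine tensor_zero (coeffForm p) (fun v hv => ?_) t fun j j' => ?_
  · refine ext_lev fun N => MvPolynomial.ext _ _ fun m => ?_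
    rw [map_zero, MvPolynomial.coeff_zero]
    exact hv ⟨N, m⟩
  · rw [formTensor_lev2, h, map_zero]

theorem exists_of_lev2_dvd (i : ℕ) (t : LambdaP p ⊗[ℤ] LambdaP p)
    (h : ∀ N M, ∃ u, lev2 p N M t = ((p : ℤ) ^ i) • u) : ∃ t', t = ((p : ℤ) ^ i) • t' := by
  induction i generalizing t with
  | zero => exact ⟨t, by simp⟩
  | succ i ih =>
    obtain ⟨t', rfl⟩ := tensor_dvd (coeffForm p) (p : ℤ) (Nat.prime_iff_prime_int.mp hp.out)
      (fun v hv => by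
        obtain ⟨y, hy⟩ := exists_of_lev_dvd p 1 v fun N => by
          have h2 : (p : MvPolynomial (Fin N) ℤ) ^ 1 = MvPolynomial.C (p : ℤ) := by simp
          rw [h2, MvPolynomial.C_dvd_iff_dvd_coeff]
          exact fun m => hv ⟨N, m⟩
        exact ⟨y, by rw [← hy]; simp⟩) t fun j j' => by
        obtain ⟨u, hu⟩ := h j.1 j'.1
        rw [formTensor_lev2, hu, map_smul, smul_eq_mul, pow_succ']
        exact (dvd_mul_right _ _).mul_right _
    obtain ⟨t'', rfl⟩ := ih t' fun N M => by
      obtain ⟨u, hu⟩ := h N M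
      refine ⟨u, ?_⟩
      rw [map_smul, pow_succ', mul_smul] at hu
      exact smul_right_injective _ (by exact_mod_cast hp.out.ne_zero : (p : ℤ) ≠ 0) hu
    exact ⟨t'', by rw [pow_succ', mul_smul]⟩

theorem exists_lift2 (b : ℕ → LambdaP p ⊗[ℤ] LambdaP p) (K : ℕ → ℕ → ℕ)
    (x : ∀ N M, Fin (K N M) → MvPolynomial (Fin N) ℤ ⊗[ℤ] MvPolynomial (Fin M) ℤ)
    (h : ∀ N M n, lev2 p N M (b n) = ∑ i, x N M i ^ p ^ n) :
    ∃ φ : LambdaP p →ₐ[ℤ] LambdaP p ⊗[ℤ] LambdaP p, ∀ n, φ (psi p n) = b n := by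
  have h1 : ∀ N M G, lev2 p N M (MvPolynomial.aeval b G) =
      evalAt p (x N M) (MvPolynomial.aeval (psi p) G) := fun N M G => by
    rw [MvPolynomial.comp_aeval_apply, MvPolynomial.comp_aeval_apply]
    congr 2
    funext n
    rw [h, evalAt_psi]
  refine exists_lift p b (fun i G f hf => ?_) (fun G hG => ?_)
  · obtain ⟨t', ht'⟩ := exists_of_lev2_dvd p i (MvPolynomial.aeval b G) fun N M => by
      refine ⟨evalAt p (x N M) f, ?_⟩
      rw [h1, ← hf, map_mul, map_pow, map_natCast, zsmul_eq_mul]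
      simp
    refine ⟨t', ?_⟩
    rw [ht', zsmul_eq_mul]
    simp
  · exact eq_zero_of_lev2 p _ fun N M => by rw [h1, hG, map_zero]

/-- The alphabet `x₁ ⊗ 1, …, x_N ⊗ 1, 1 ⊗ y₁, …, 1 ⊗ y_M`. -/
def sumAlphabet (N M : ℕ) :
    Fin (N + M) → MvPolynomial (Fin N) ℤ ⊗[ℤ] MvPolynomial (Fin M) ℤ :=
  Fin.append (fun i => MvPolynomial.X i ⊗ₜ 1) (fun j => 1 ⊗ₜ MvPolynomial.X j)

/-- The alphabet of all `x_i ⊗ y_j`. -/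
def prodAlphabet (N M : ℕ) :
    Fin (N * M) → MvPolynomial (Fin N) ℤ ⊗[ℤ] MvPolynomial (Fin M) ℤ :=
  fun l => MvPolynomial.X (finProdFinEquiv.symm l).1 ⊗ₜ MvPolynomial.X (finProdFinEquiv.symm l).2

theorem exists_coadd : ∃ φ : LambdaP p →ₐ[ℤ] LambdaP p ⊗[ℤ] LambdaP p,
    ∀ n, φ (psi p n) = psi p n ⊗ₜ 1 + 1 ⊗ₜ psi p n := by
  refine exists_lift2 p _ (fun N M => N + M) sumAlphabet fun N M n => ?_
  simp only [lev2, map_add, Algebra.TensorProduct.map_tmul, map_one, lev_psi, Fin.sum_univ_add,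
    sumAlphabet, Fin.append_left, Fin.append_right, Algebra.TensorProduct.tmul_pow, one_pow,
    TensorProduct.sum_tmul, TensorProduct.tmul_sum]

theorem exists_comul : ∃ φ : LambdaP p →ₐ[ℤ] LambdaP p ⊗[ℤ] LambdaP p,
    ∀ n, φ (psi p n) = psi p n ⊗ₜ psi p n := by
  refine exists_lift2 p _ (fun N M => N * M) prodAlphabet fun N M n => ?_
  rw [← finProdFinEquiv.sum_comp]
  simp only [lev2, Algebra.TensorProduct.map_tmul, lev_psi, prodAlphabet,
    Equiv.symm_apply_apply, Algebra.TensorProduct.tmul_pow, Fintype.sum_prod_type,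
    TensorProduct.sum_tmul, TensorProduct.tmul_sum]
  exact Finset.sum_comm

/-- The data of the plethory structure on `Λ_p`. -/
def data : RingLikeData ℕ ℤ (LambdaP p) where
  psi := psi p
  frob := frob p
  frob_psi := frob_psi p
  coadd := (exists_coadd p).choose
  coadd_psi := (exists_coadd p).choose_spec
  comul := (exists_comul p).choose
  comul_psi := (exists_comul p).choose_spec
  colin c := (exists_colin p c).choose
  colin_psi c := (exists_colin p c).choose_spec
  comp g := (exists_comp p g).choose
  comp_psi g := (exists_comp p g).choose_spec
  ext0 := hom_ext p
  ext1 := hom_ext p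
  ext2 := hom_ext p
  ext3 := @hom_ext p _ _ _ _ (torsionFree_int _ _ _
    (torsionFree_tensor (R := ℤ) (M := LambdaP p) (N := LambdaP p ⊗[ℤ] LambdaP p)))

end LambdaP

instance (p : ℕ) [Fact p.Prime] : Plethory ℤ (LambdaP p) := (LambdaP.data p).plethory

namespace LambdaP
variable (p : ℕ) [hp : Fact p.Prime]

/-- Coaddition on `Λ_p` is `f ↦ f(x₁ ⊗ 1, 1 ⊗ x₁, x₂ ⊗ 1, 1 ⊗ x₂, …)`. -/
theorem coadd_eq (N M : ℕ) (f : LambdaP p) :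
    lev2 p N M (Biring.coadd ℤ f) = evalAt p (sumAlphabet N M) f := by
  have key : (lev2 p N M).comp (data p).coadd = evalAt p (sumAlphabet N M) :=
    hom_ext p _ _ fun n => by
      rw [AlgHom.comp_apply]
      erw [(data p).coadd_psi n]
      rw [evalAt_psi]
      simp only [data, lev2, map_add, Algebra.TensorProduct.map_tmul, map_one, lev_psi,
        Fin.sum_univ_add, sumAlphabet, Fin.append_left, Fin.append_right,
        Algebra.TensorProduct.tmul_pow, one_pow, TensorProduct.sum_tmul, TensorProduct.tmul_sum]
  exact DFunLike.congr_fun key f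

/-- Comultiplication on `Λ_p` is `f ↦ f(…, x_i ⊗ x_j, …)`. -/
theorem comul_eq (N M : ℕ) (f : LambdaP p) :
    lev2 p N M (Biring.comul ℤ f) = evalAt p (prodAlphabet N M) f := by
  have key : (lev2 p N M).comp (data p).comul = evalAt p (prodAlphabet N M) :=
    hom_ext p _ _ fun n => by
      rw [AlgHom.comp_apply]
      erw [(data p).comul_psi n]
      rw [evalAt_psi, ← finProdFinEquiv.sum_comp]
      simp only [data, lev2, Algebra.TensorProduct.map_tmul, lev_psi, prodAlphabet,
        Equiv.symm_apply_apply, Algebra.TensorProduct.tmul_pow, Fintype.sum_prod_type,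
        TensorProduct.sum_tmul, TensorProduct.tmul_sum]
      exact Finset.sum_comm
  exact DFunLike.congr_fun key f

/-- The composition on `Λ_p` is plethysm: if `g` in `N` variables is a sum of monomials
`m₁ + ⋯ + m_K` with coefficient `1`, then `f ∘ g` in `N` variables is `f(m₁, …, m_K)`. -/
theorem circ_eq (N K : ℕ) (m : Fin K → (Fin N →₀ ℕ)) (f g : LambdaP p)
    (hg : lev p N g = ∑ j, MvPolynomial.monomial (m j) (1 : ℤ)) :
    lev p N (Plethory.circ ℤ f g) =
      evalAt p (fun j => MvPolynomial.monomial (m j) (1 : ℤ)) f := by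
  have key : (lev p N).comp ((data p).comp g) =
      evalAt p (fun j => MvPolynomial.monomial (m j) (1 : ℤ)) :=
    hom_ext p _ _ fun n => by
      rw [AlgHom.comp_apply]
      erw [(data p).comp_psi g n]
      rw [evalAt_psi]
      change lev p N (frob p n g) = _
      rw [lev_frob, hg, map_sum]
      exact Finset.sum_congr rfl fun j _ => by
        rw [MvPolynomial.expand_monomial, MvPolynomial.monomial_pow, one_pow]
  exact DFunLike.congr_fun key f

end LambdaP

/-- The map of plethories `ℤ⟨F⟩ → Λ_p` sending `F^{∘n}` to `ψ_{p^n}`. -/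
def zfToLambdaP (p : ℕ) [Fact p.Prime] : PlethoryMap ℤ ZF (LambdaP p) where
  hom := MvPolynomial.aeval (LambdaP.psi p)
  map_coadd α := by
    have key : (LambdaP.data p).coadd.comp (MvPolynomial.aeval (LambdaP.psi p)) =
        (Algebra.TensorProduct.productMap
          ((pt1 ℤ (LambdaP p)).comp (MvPolynomial.aeval (LambdaP.psi p)))
          ((pt2 ℤ (LambdaP p)).comp (MvPolynomial.aeval (LambdaP.psi p)))).comp zfData.coadd := by
      refine MvPolynomial.algHom_ext fun n => ?_
      have h1 := zfData.coadd_psi n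
      have h2 := (LambdaP.data p).coadd_psi n
      simp only [zfData, LambdaP.data] at h1 h2 ⊢
      simp only [AlgHom.comp_apply, MvPolynomial.aeval_X, h1, h2, map_add,
        Algebra.TensorProduct.productMap_apply_tmul, map_one, mul_one, one_mul,
        Algebra.TensorProduct.includeLeft_apply, Algebra.TensorProduct.includeRight_apply]
    exact DFunLike.congr_fun key α
  map_comul α := by
    have key : (LambdaP.data p).comul.comp (MvPolynomial.aeval (LambdaP.psi p)) =
        (Algebra.TensorProduct.productMap
          ((pt1 ℤ (LambdaP p)).comp (MvPolynomial.aeval (LambdaP.psi p)))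
          ((pt2 ℤ (LambdaP p)).comp (MvPolynomial.aeval (LambdaP.psi p)))).comp zfData.comul := by
      refine MvPolynomial.algHom_ext fun n => ?_
      have h1 := zfData.comul_psi n
      have h2 := (LambdaP.data p).comul_psi n
      simp only [zfData, LambdaP.data] at h1 h2 ⊢
      simp only [AlgHom.comp_apply, MvPolynomial.aeval_X, h1, h2,
        Algebra.TensorProduct.productMap_apply_tmul, mul_one, one_mul,
        Algebra.TensorProduct.includeLeft_apply, Algebra.TensorProduct.includeRight_apply,
        Algebra.TensorProduct.tmul_mul_tmul]
    exact DFunLike.congr_fun key α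
  map_colin c α := by
    have key : ((LambdaP.data p).colin c).comp (MvPolynomial.aeval (LambdaP.psi p)) =
        zfData.colin c := by
      refine MvPolynomial.algHom_ext fun n => ?_
      have h1 := zfData.colin_psi c n
      have h2 := (LambdaP.data p).colin_psi c n
      simp only [zfData, LambdaP.data] at h1 h2 ⊢
      simp only [AlgHom.comp_apply, MvPolynomial.aeval_X, h1, h2]
    exact DFunLike.congr_fun key α
  map_circ α β := by
    have h : ∀ m, MvPolynomial.aeval (LambdaP.psi p) (MvPolynomial.rename (fun n => m + n) β) =
        LambdaP.frob p m (MvPolynomial.aeval (LambdaP.psi p) β) := fun m => by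
      have key : (MvPolynomial.aeval (LambdaP.psi p)).comp
          (MvPolynomial.rename (fun n => m + n)) =
          (LambdaP.frob p m).comp (MvPolynomial.aeval (LambdaP.psi p)) :=
        MvPolynomial.algHom_ext fun n => by
          simp only [AlgHom.comp_apply, MvPolynomial.rename_X, MvPolynomial.aeval_X,
            LambdaP.frob_psi]
      exact DFunLike.congr_fun key β
    have key : (MvPolynomial.aeval (LambdaP.psi p)).comp (zfData.comp β) =
        ((LambdaP.data p).comp (MvPolynomial.aeval (LambdaP.psi p) β)).comp
          (MvPolynomial.aeval (LambdaP.psi p)) := by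
      refine MvPolynomial.algHom_ext fun m => ?_
      have h1 := zfData.comp_psi β m
      have h2 := (LambdaP.data p).comp_psi (MvPolynomial.aeval (LambdaP.psi p) β) m
      simp only [zfData, LambdaP.data] at h1 h2 ⊢
      simp only [AlgHom.comp_apply, MvPolynomial.aeval_X, h1, h2, h]
    exact DFunLike.congr_fun key α
  map_unit := MvPolynomial.aeval_X _ _

end

/-! ## Torsion in tensor products -/

/-! The trivial plethory acts on an `𝔽_p`-algebra in only one way, with `e^q` acting as the `q`-th
power. Hence a deformation is a ring on which `p` is regular and each `F^{∘n}` lifts the `p^n`-th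
power map modulo `p` (`isDeformation_zfToTrivial_iff`). `Λ_p` is one: there `F^{∘n}` is `f(x) ↦
f(x^{p^n})`, the congruence holds in every polynomial ring, and `Λ_p` is `p`-saturated in their
product. It remains to see that `Λ_p` is initial.

Existence of a ring map. Let `B` be `p`-torsion-free with a Frobenius lift `F`, and write `F x = x^p
+ p δ(x)`. A map `Λ_p → B` with `ψ_{p^n} ↦ F^n(r)` exists as soon as `p^i f = G(ψ_1, ψ_p, …)` forces
`p^i ∣ G(r, F r, …)`. Now `G(r, F r, …)` is the value at `(r, δ r, δ² r, …)` of a polynomial `H`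
over `ℤ` depending only on `G`, so it suffices that `p^i ∣ H`. This is tested in a single family of
examples, `r ∈ ℤ[x]` with Frobenius lift `x ↦ x^p`. There `p^i` divides the value by `lev_dvd`:
modulo `p^i`, `r` is a sum of monomials, at which `f` can be evaluated. The examples suffice because
the sequences `(r, δ r, δ² r, …)` modulo `p` satisfy no common polynomial relation
(`eq_zero_of_eval_deltaMod`): adding `p^k y` to `r` leaves `δ^j r` unchanged modulo `p` for `j < k`
and moves `δ^k r` by `F^k y`. This argument needs no presentation of `Λ_p` by generators and
relations.

Uniqueness and structure. Every element of `Λ_p` has a `p`-power multiple in `ℤ[ψ_1, ψ_p, …]`, so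
maps to a `p`-torsion-free ring are determined by the `ψ_{p^n}`. The same principle turns a ring map
under `ℤ⟨F⟩` into a map of plethories (`LambdaP.plethoryMapOfHom`), once `P ⊗ P` is known to have no
`p`-torsion. The plethory `P` may have torsion at other primes, so this last fact is obtained by
localising at `(p)`. -/

/-- At the prime `(p)` every nonzero scalar is a unit times a power of `p`, so only `p`-torsion
could survive localisation. -/
theorem isTorsionFree_localizedModule_primeCompl {R M : Type*} [CommRing R] [IsDomain R]
    [IsPrincipalIdealRing R] [AddCommGroup M] [Module R M] {p : R} (hp : Prime p)
    [(Ideal.span {p}).IsPrime] (hM : ∀ x : M, p • x = 0 → x = 0) :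
    Module.IsTorsionFree R (LocalizedModule (Ideal.span {p}).primeCompl M) := by
  have hpow : ∀ (a : ℕ) (x : M), p ^ a • x = 0 → x = 0 := fun a x hx => by
    induction a with
    | zero => simpa using hx
    | succ a ih => exact ih (hM _ (by rwa [← mul_smul, ← pow_succ']))
  have key : ∀ (r : R) (x : LocalizedModule (Ideal.span {p}).primeCompl M),
      r ≠ 0 → r • x = 0 → x = 0 := by
    intro r x hr hx
    induction x using LocalizedModule.induction_on with | _ m s
    rw [LocalizedModule.smul'_mk, IsLocalizedModule.mk_eq_mk', IsLocalizedModule.mk'_eq_zero'] at hx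
    obtain ⟨c, hc⟩ := hx
    have hc0 : (c : R) ≠ 0 := fun h => c.2 (by rw [h]; exact Ideal.zero_mem _)
    -- Write `c r = p^a v` with `p ∤ v`; the power `p^a` cancels on `M`, and `v` becomes the
    -- denominator witnessing that `m/s` is zero.
    obtain ⟨a, v, hv, hcr⟩ := WfDvdMonoid.max_power_factor (mul_ne_zero hc0 hr) hp.irreducible
    rw [IsLocalizedModule.mk_eq_mk', IsLocalizedModule.mk'_eq_zero']
    refine ⟨⟨v, fun h => hv (Ideal.mem_span_singleton.mp h)⟩, hpow a _ ?_⟩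
    change p ^ a • v • m = 0
    rw [← mul_smul, ← hcr, mul_smul]
    exact hc
  refine ⟨fun r hr x y hxy => sub_eq_zero.mp (key r _ hr.ne_zero ?_)⟩
  rw [smul_sub, sub_eq_zero]
  exact hxy

/-- Over a principal ideal domain, a tensor product of modules without `p`-torsion has no
`p`-torsion. -/
theorem eq_zero_of_prime_smul_tensor {R M N : Type*} [CommRing R] [IsDomain R]
    [IsPrincipalIdealRing R] [AddCommGroup M] [Module R M] [AddCommGroup N] [Module R N] {p : R}
    (hp : Prime p) (hM : ∀ x : M, p • x = 0 → x = 0) (hN : ∀ x : N, p • x = 0 → x = 0)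
    (t : M ⊗[R] N) (ht : p • t = 0) : t = 0 := by
  have hP : (Ideal.span {p}).IsPrime := (Ideal.span_singleton_prime hp.ne_zero).mpr hp
  let S := (Ideal.span {p}).primeCompl
  let f := LocalizedModule.mkLinearMap S M
  let g := LocalizedModule.mkLinearMap S N
  have := isTorsionFree_localizedModule_primeCompl hp hM
  have := isTorsionFree_localizedModule_primeCompl hp hN
  -- Both localisations are torsion-free over the principal ideal domain `R`, hence so is their
  -- tensor product.
  have h0 : TensorProduct.map f g t = 0 := by
    have h1 : p • TensorProduct.map f g t = 0 := by rw [← map_smul, ht, map_zero]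
    exact (smul_eq_zero.mp h1).resolve_left hp.ne_zero
  -- The map `f ⊗ g` is again a localisation, so `t` is killed by some `c` prime to `p`. It is also
  -- killed by `p`, and Bézout concludes.
  obtain ⟨c, hc⟩ := (IsLocalizedModule.eq_zero_iff S (TensorProduct.map f g)).mp h0
  have hc' : ¬ p ∣ (c : R) := fun h => c.2 (Ideal.mem_span_singleton.mpr h)
  obtain ⟨a, b, hab⟩ := hp.irreducible.coprime_iff_not_dvd.mpr hc'
  rw [← one_smul R t, ← hab, add_smul, mul_smul, mul_smul, ht, smul_zero, zero_add]
  change b • c • t = 0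
  rw [hc, smul_zero]

/-! ## Operators lifting Frobenius -/

/-- In `x^p - y^p = (∑ x^a y^b)(x - y)` the sum has `p` terms that agree modulo `p`, which gains one
factor `p`. -/
theorem dvd_pow_sub_pow_succ {R : Type*} [CommRing R] {p k : ℕ} {x y : R}
    (h : (p : R) ^ (k + 1) ∣ x - y) : (p : R) ^ (k + 2) ∣ x ^ p - y ^ p := by
  rw [← (Commute.all x y).geom_sum₂_mul p, pow_succ' (p : R) (k + 1)]
  exact mul_dvd_mul (dvd_geom_sum₂_self ((dvd_pow_self _ k.succ_ne_zero).trans h)) h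

/-! ### Perturbing the argument of `δ` by powers of `p` -/

section delta
variable {R : Type*} [CommRing R] {p : ℕ}

/-- In `p δ(x) = F x - x^p` the first term is additive, while the `p`-th powers agree to one order
higher than their arguments. Dividing by `p` costs one order of precision. -/
theorem dvd_delta_sub (hreg : IsLeftRegular (p : R)) (F : R →+* R) (δ : R → R)
    (hδ : ∀ x, F x = x ^ p + p * δ x) (k : ℕ) {x x' y : R}
    (h : (p : R) ^ (k + 2) ∣ x' - x - p ^ (k + 1) * y) :
    (p : R) ^ (k + 1) ∣ δ x' - δ x - p ^ k * F y := by
  have h1 : (p : R) ^ (k + 2) ∣ F (x' - x - p ^ (k + 1) * y) := by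
    simpa using map_dvd F h
  have h2 : (p : R) ^ (k + 1) ∣ x' - x :=
    (dvd_sub_left (dvd_mul_right _ y)).mp ((pow_dvd_pow _ (k + 1).le_succ).trans h)
  obtain ⟨c, hc⟩ := dvd_sub h1 (dvd_pow_sub_pow_succ h2)
  refine ⟨c, hreg ?_⟩
  simp only [map_sub, map_mul, map_pow, map_natCast] at hc
  rw [hδ x, hδ x'] at hc
  linear_combination hc

/-- Each `δ` lowers the power of `p` in front of the perturbation by one and applies `F` to `y`. The
perturbation is invisible modulo `p` until exactly as many iterations as its exponent. -/
theorem dvd_iterate_delta_sub (hreg : IsLeftRegular (p : R)) (F : R →+* R) (δ : R → R)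
    (hδ : ∀ x, F x = x ^ p + p * δ x) (j l : ℕ) (x y : R) :
    (p : R) ^ (l + 1) ∣ δ^[j] (x + p ^ (j + l) * y) - δ^[j] x - p ^ l * F^[j] y := by
  induction j generalizing l with
  | zero => simp
  | succ j ih =>
    simp only [Function.iterate_succ_apply']
    refine dvd_delta_sub hreg F δ hδ l ?_
    have h := ih (l + 1)
    rwa [show j + (l + 1) = j + 1 + l by omega] at h

theorem dvd_iterate_delta_sub_of_lt (hreg : IsLeftRegular (p : R)) (F : R →+* R) (δ : R → R)
    (hδ : ∀ x, F x = x ^ p + p * δ x) {j k : ℕ} (hjk : j < k) (x y : R) :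
    (p : R) ∣ δ^[j] (x + p ^ k * y) - δ^[j] x := by
  obtain ⟨l, rfl⟩ := Nat.exists_eq_add_of_lt hjk
  have h := dvd_iterate_delta_sub hreg F δ hδ j (l + 1) x y
  have h1 := (dvd_pow_self (p : R) (l + 1).succ_ne_zero).trans h
  exact (dvd_sub_left ((dvd_pow_self _ l.succ_ne_zero).mul_right _)).mp h1

theorem dvd_iterate_delta_sub_self (hreg : IsLeftRegular (p : R)) (F : R →+* R) (δ : R → R)
    (hδ : ∀ x, F x = x ^ p + p * δ x) (k : ℕ) (x y : R) :
    (p : R) ∣ δ^[k] (x + p ^ k * y) - δ^[k] x - F^[k] y := by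
  simpa using dvd_iterate_delta_sub hreg F δ hδ k 0 x y

end delta

/-- The Frobenius lift on the polynomial ring `ℤ[e, δ(e), δ(δ(e)), …]`. -/
noncomputable def deltaFrob (p : ℕ) : MvPolynomial ℕ ℤ →ₐ[ℤ] MvPolynomial ℕ ℤ :=
  MvPolynomial.aeval fun n => MvPolynomial.X n ^ p + (p : MvPolynomial ℕ ℤ) * MvPolynomial.X (n + 1)

/-- Evaluation at `(r, δ r, δ² r, …)` intertwines the universal Frobenius lift with `F`, so `F^n(r)`
is a universal polynomial in the `δ^m(r)`. -/
theorem aeval_iterate_deltaFrob {R : Type*} [CommRing R] [Algebra ℤ R] {p : ℕ} (F : R →ₐ[ℤ] R)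
    (δ : R → R) (hδ : ∀ x, F x = x ^ p + p * δ x) (r : R) (n : ℕ) :
    MvPolynomial.aeval (fun m => δ^[m] r) ((deltaFrob p)^[n] (MvPolynomial.X 0)) = F^[n] r := by
  have key : (MvPolynomial.aeval fun m => δ^[m] r).comp (deltaFrob p) =
      F.comp (MvPolynomial.aeval fun m => δ^[m] r) :=
    MvPolynomial.algHom_ext fun m => by
      simp [deltaFrob, hδ, Function.iterate_succ_apply']
  have h : Function.Semiconj (MvPolynomial.aeval fun m => δ^[m] r) (deltaFrob p) F :=
    DFunLike.congr_fun key
  rw [h.iterate_right n]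
  simp

/-! ### Independence modulo `p` of the iterates of `δ` on `ℤ[x]` -/

section algebraicIndependence
open MvPolynomial

theorem iterate_expand {σ : Type*} (p : ℕ) (n : ℕ) (g : MvPolynomial σ ℤ) :
    (expand p)^[n] g = expand (p ^ n) g := by
  induction n with
  | zero => simp
  | succ n ih => rw [Function.iterate_succ_apply', ih, pow_succ', expand_mul]

variable (p : ℕ) [hp : Fact p.Prime]

/-- Over `𝔽_p`, substituting `x^p` for each variable is the Frobenius endomorphism. -/
theorem dvd_expand_sub_pow {σ : Type*} (g : MvPolynomial σ ℤ) :
    (p : MvPolynomial σ ℤ) ∣ expand p g - g ^ p := by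
  have h : (p : MvPolynomial σ ℤ) = C (p : ℤ) := by simp
  rw [h, C_dvd_iff_zmod, map_sub, sub_eq_zero, map_expand, map_pow, expand_zmod]

/-- The operator `g ↦ (g(x^p) - g(x)^p) / p` on integral polynomials. -/
noncomputable def expandDelta {σ : Type*} (g : MvPolynomial σ ℤ) : MvPolynomial σ ℤ :=
  (dvd_expand_sub_pow p g).choose

theorem expand_eq_pow_add {σ : Type*} (g : MvPolynomial σ ℤ) :
    expand p g = g ^ p + p * expandDelta p g := by
  exact eq_add_of_sub_eq' (dvd_expand_sub_pow p g).choose_spec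

theorem isLeftRegular_natCast_mvPolynomial (σ : Type*) :
    IsLeftRegular (p : MvPolynomial σ ℤ) :=
  IsLeftCancelMulZero.mul_left_cancel_of_ne_zero (Nat.cast_ne_zero.mpr hp.out.ne_zero)

/-- The reduction modulo `p` of `δ^n(r)`, for an integral polynomial `r` in one variable. -/
noncomputable def deltaMod (r : MvPolynomial (Fin 1) ℤ) (n : ℕ) : MvPolynomial (Fin 1) (ZMod p) :=
  map (Int.castRingHom (ZMod p)) ((expandDelta p)^[n] r)

theorem map_castRingHom_eq_of_dvd {σ : Type*} {a b : MvPolynomial σ ℤ}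
    (h : (p : MvPolynomial σ ℤ) ∣ a - b) :
    map (Int.castRingHom (ZMod p)) a = map (Int.castRingHom (ZMod p)) b := by
  have h1 : (p : MvPolynomial σ ℤ) = C (p : ℤ) := by simp
  rwa [h1, C_dvd_iff_zmod, map_sub, sub_eq_zero] at h

theorem deltaMod_add_of_lt {j k : ℕ} (hjk : j < k) (x y : MvPolynomial (Fin 1) ℤ) :
    deltaMod p (x + p ^ k * y) j = deltaMod p x j :=
  map_castRingHom_eq_of_dvd p <| dvd_iterate_delta_sub_of_lt
    (isLeftRegular_natCast_mvPolynomial p _) (expand p : _ →ₐ[ℤ] _).toRingHom (expandDelta p)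
    (expand_eq_pow_add p) hjk x y

theorem deltaMod_add_X_pow (k m : ℕ) (x : MvPolynomial (Fin 1) ℤ) :
    deltaMod p (x + p ^ k * (X 0 : MvPolynomial (Fin 1) ℤ) ^ m) k = deltaMod p x k + X 0 ^ (p ^ k * m) := by
  have h := map_castRingHom_eq_of_dvd p (a := _ - _) <| dvd_iterate_delta_sub_self
    (isLeftRegular_natCast_mvPolynomial p _) (expand p : _ →ₐ[ℤ] _).toRingHom (expandDelta p)
    (expand_eq_pow_add p) k x (X 0 ^ m)
  have h1 : (expand p : _ →ₐ[ℤ] MvPolynomial (Fin 1) ℤ).toRingHom^[k] (X 0 ^ m) =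
      X 0 ^ (p ^ k * m) := by
    rw [pow_mul]
    exact (iterate_expand p k _).trans (by simp)
  rw [h1, map_sub, sub_eq_iff_eq_add'] at h
  simpa [deltaMod] using h

/-- The perturbations `y = x^m` move the value by `x^{p^k m}`, and these are distinct. It is here
that `ℤ[x]` is used instead of `ℤ`, whose reduction modulo `p` is finite. -/
theorem infinite_range_deltaMod (k : ℕ) (x : MvPolynomial (Fin 1) ℤ) :
    (Set.range fun y => deltaMod p (x + p ^ k * y) k).Infinite := by
  refine (Set.infinite_range_of_injective (f := fun m : ℕ =>
    deltaMod p (x + p ^ k * (X 0 : MvPolynomial (Fin 1) ℤ) ^ m) k) fun m n hmn => ?_).mono ?_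
  · simp only [deltaMod_add_X_pow, add_right_inj] at hmn
    have h := congrArg totalDegree hmn
    rw [totalDegree_X_pow, totalDegree_X_pow] at h
    exact Nat.eq_of_mul_eq_mul_left (pow_pos hp.out.pos k) h
  · rintro _ ⟨m, rfl⟩
    exact ⟨X 0 ^ m, rfl⟩

/-- A polynomial vanishes if it vanishes at all sequences `δ^k(r'), …, δ^(k + n - 1)(r')` modulo
`p` with `r' ≡ r` modulo `p^k`. -/
theorem eq_zero_of_eval_deltaMod (n k : ℕ) (r : MvPolynomial (Fin 1) ℤ)
    (H : MvPolynomial (Fin n) (MvPolynomial (Fin 1) (ZMod p)))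
    (hH : ∀ y, eval (fun i : Fin n => deltaMod p (r + p ^ k * y) (k + i)) H = 0) : H = 0 := by
  induction n generalizing k r with
  | zero =>
    obtain ⟨c, rfl⟩ := C_surjective (Fin 0) H
    have h := hH 0
    rw [eval_C] at h
    rw [h, C_0]
  | succ n ih =>
    -- View `H` as a polynomial in its first variable over the domain of polynomials in the others.
    -- The infinitely many constants `δ^k(r + p^k y)` modulo `p` are shown to be roots.
    refine (finSuccEquiv _ n).map_eq_zero_iff.mp (Polynomial.eq_zero_of_infinite_isRoot _ ?_)
    refine ((infinite_range_deltaMod p k r).image (C_injective (Fin n) _).injOn).mono ?_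
    rintro _ ⟨_, ⟨y, rfl⟩, rfl⟩
    refine ih (k + 1) (r + p ^ k * y) _ fun z => ?_
    -- Replacing `y` by `y + p z` perturbs `r + p^k y` by `p^(k+1) z`. This fixes the first
    -- coordinate and leaves the later ones free, as the induction hypothesis at `k + 1` requires.
    have h := hH (y + p * z)
    rw [show r + (p : MvPolynomial (Fin 1) ℤ) ^ k * (y + p * z) =
      r + p ^ k * y + p ^ (k + 1) * z by ring] at h
    have hs : (fun i : Fin (n + 1) => deltaMod p (r + p ^ k * y + p ^ (k + 1) * z) (k + i)) =
        Fin.cons (deltaMod p (r + p ^ k * y) k)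
          (fun i : Fin n => deltaMod p (r + p ^ k * y + p ^ (k + 1) * z) (k + 1 + i)) := by
      funext i
      refine Fin.cases ?_ (fun i => ?_) i
      · exact deltaMod_add_of_lt p k.lt_succ_self _ _
      · simp only [Fin.cons_succ, Fin.val_succ]
        congr 1
        omega
    rw [hs, eval_eq_eval_mv_eval'] at h
    rw [← Polynomial.eval₂_at_apply, eval_C, Polynomial.eval₂_eq_eval_map]
    exact h

/-- A polynomial in `e, δ(e), δ(δ(e)), …` is divisible by `p` if its values at all integral
polynomials in one variable are. -/
theorem dvd_of_dvd_aeval_expandDelta (H : MvPolynomial ℕ ℤ)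
    (hH : ∀ r : MvPolynomial (Fin 1) ℤ,
      (p : MvPolynomial (Fin 1) ℤ) ∣ aeval (fun n => (expandDelta p)^[n] r) H) :
    (p : MvPolynomial ℕ ℤ) ∣ H := by
  have h1 : ∀ σ, (p : MvPolynomial σ ℤ) = C (p : ℤ) := by simp
  rw [h1, C_dvd_iff_zmod]
  simp only [h1 (Fin 1), C_dvd_iff_zmod] at hH
  -- Only finitely many variables occur in `H` modulo `p`, so it comes from a polynomial `q` in `n`
  -- variables. Its coefficients are then enlarged from `𝔽_p` to `𝔽_p[x]`, where the test values
  -- lie.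
  obtain ⟨n, hn⟩ : ∃ n, ∀ i ∈ (map (Int.castRingHom (ZMod p)) H).vars, i < n :=
    ⟨_, fun i hi => Nat.lt_succ_of_le (Finset.le_sup (f := id) hi)⟩
  obtain ⟨q, hq⟩ := exists_rename_eq_of_vars_subset_range (map (Int.castRingHom (ZMod p)) H)
    (Fin.val : Fin n → ℕ) Fin.val_injective fun i hi => ⟨⟨i, hn i hi⟩, rfl⟩
  have h2 : map (C : ZMod p →+* MvPolynomial (Fin 1) (ZMod p)) q = 0 := by
    -- With `k = 0` and `r = 0` the argument `r + p^k y` runs through all of `ℤ[x]`.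
    refine eq_zero_of_eval_deltaMod p n 0 0 _ fun y => ?_
    have h3 := hH y
    rw [map_aeval, coe_eval₂Hom] at h3
    rw [eval_map]
    have h4 := eval₂_rename (C : ZMod p →+* MvPolynomial (Fin 1) (ZMod p)) Fin.val (deltaMod p y) q
    rw [hq, eval₂_map] at h4
    simp only [pow_zero, one_mul, zero_add]
    refine h4.symm.trans (Eq.trans ?_ h3)
    congr 1
    exact RingHom.ext_int _ _
  have h3 : q = 0 := map_injective _ (C_injective _ _) (by rw [h2, map_zero])
  rw [← hq, h3, map_zero]

/-- Factors of `p` are removed from `H` one at a time; the hypothesis passes to the quotient because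
`p` cancels in `ℤ[x]`. -/
theorem pow_dvd_of_pow_dvd_aeval_expandDelta (i : ℕ) (H : MvPolynomial ℕ ℤ)
    (hH : ∀ r : MvPolynomial (Fin 1) ℤ,
      (p : MvPolynomial (Fin 1) ℤ) ^ i ∣ aeval (fun n => (expandDelta p)^[n] r) H) :
    (p : MvPolynomial ℕ ℤ) ^ i ∣ H := by
  induction i generalizing H with
  | zero => simp
  | succ i ih =>
    obtain ⟨H, rfl⟩ := dvd_of_dvd_aeval_expandDelta p H fun r =>
      (dvd_pow_self _ i.succ_ne_zero).trans (hH r)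
    rw [pow_succ']
    refine mul_dvd_mul_left _ (ih H fun r => ?_)
    have h := hH r
    rw [map_mul, map_natCast, pow_succ'] at h
    exact (mul_dvd_mul_iff_left (Nat.cast_ne_zero.mpr hp.out.ne_zero)).mp h

end algebraicIndependence

/-! ## Homomorphisms from `Λ_p` to rings without `p`-torsion -/

namespace LambdaP
variable (p : ℕ) [hp : Fact p.Prime] {B : Type*} [CommRing B] [Algebra ℤ B]

/-- Strengthens `hom_ext`: only powers of `p` have to be cancelled, so `B` may have torsion at other
primes, as a general deformation may. -/
theorem hom_ext_of_isLeftRegular (hB : IsLeftRegular (p : B)) (φ χ : LambdaP p →ₐ[ℤ] B)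
    (h : ∀ n, φ (psi p n) = χ (psi p n)) : φ = χ := by
  refine AlgHom.ext fun f => ?_
  obtain ⟨i, G, hG⟩ := exists_ghost p f
  have key : φ.comp (MvPolynomial.aeval (psi p)) = χ.comp (MvPolynomial.aeval (psi p)) :=
    MvPolynomial.algHom_ext fun n => by simpa using h n
  have h1 := DFunLike.congr_fun key G
  rw [AlgHom.comp_apply, AlgHom.comp_apply, ← hG] at h1
  simp only [map_mul, map_pow, map_natCast] at h1
  exact hB.pow i h1

/-- The image of `f` is the quotient of `G(b)` by `p^i`. It exists by `H`, and `H0` makes it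
independent of the chosen pair `(i, G)`. -/
theorem exists_lift_of_isLeftRegular (hB : IsLeftRegular (p : B)) (b : ℕ → B)
    (H : ∀ (i : ℕ) (G : MvPolynomial ℕ ℤ) (f : LambdaP p),
      (p : LambdaP p) ^ i * f = MvPolynomial.aeval (psi p) G →
        (p : B) ^ i ∣ MvPolynomial.aeval b G)
    (H0 : ∀ G : MvPolynomial ℕ ℤ, MvPolynomial.aeval (psi p) G = 0 →
      MvPolynomial.aeval b G = 0) :
    ∃ φ : LambdaP p →ₐ[ℤ] B, ∀ n, φ (psi p n) = b n := by
  have h : ∀ f : LambdaP p, ∃ x : B, ∀ (i : ℕ) (G : MvPolynomial ℕ ℤ),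
      (p : LambdaP p) ^ i * f = MvPolynomial.aeval (psi p) G →
        (p : B) ^ i * x = MvPolynomial.aeval b G := by
    intro f
    obtain ⟨i, G, hG⟩ := exists_ghost p f
    obtain ⟨x, hx⟩ := H i G f hG
    refine ⟨x, fun j G' hG' => hB.pow i ?_⟩
    -- Two descriptions of the same `f` differ by the relation `p^j G - p^i G'` between the
    -- `ψ_{p^n}`.
    have h1 := H0 ((p : MvPolynomial ℕ ℤ) ^ j * G - (p : MvPolynomial ℕ ℤ) ^ i * G') (by
      simp only [map_sub, map_mul, map_pow, map_natCast, ← hG, ← hG']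
      ring)
    simp only [map_sub, map_mul, map_pow, map_natCast, hx] at h1
    change (p : B) ^ i * _ = (p : B) ^ i * _
    linear_combination h1
  choose φ hφ using h
  refine ⟨intAlgHom
    { toFun := φ
      map_one' := by simpa using hφ 1 0 1 (by simp)
      map_zero' := by simpa using hφ 0 0 0 (by simp)
      map_add' := fun f g => by
        obtain ⟨i, G, hG⟩ := exists_ghost p f
        obtain ⟨j, G', hG'⟩ := exists_ghost p g
        have h3 := hφ (f + g) (i + j)
          ((p : MvPolynomial ℕ ℤ) ^ j * G + (p : MvPolynomial ℕ ℤ) ^ i * G') (by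
            simp only [map_add, map_mul, map_pow, map_natCast, ← hG, ← hG']; ring)
        simp only [map_add, map_mul, map_pow, map_natCast, ← hφ f i G hG, ← hφ g j G' hG'] at h3
        refine hB.pow (i + j) (h3.trans ?_)
        ring
      map_mul' := fun f g => by
        obtain ⟨i, G, hG⟩ := exists_ghost p f
        obtain ⟨j, G', hG'⟩ := exists_ghost p g
        have h3 := hφ (f * g) (i + j) (G * G') (by
            simp only [map_mul, ← hG, ← hG']; ring)
        simp only [map_mul, ← hφ f i G hG, ← hφ g j G' hG'] at h3
        refine hB.pow (i + j) (h3.trans ?_)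
        ring }, fun n => ?_⟩
  have h1 : φ (psi p n) = b n := by simpa using hφ (psi p n) 0 (MvPolynomial.X n) (by simp)
  exact h1

/-- If `p^i f = G(ψ_1, ψ_p, …)` in `Λ_p`, then `p^i` divides `G(e, F(e), F(F(e)), …)` in the
polynomial ring `ℤ[e, δ(e), δ(δ(e)), …]`. -/
theorem pow_dvd_aeval_iterate_deltaFrob (i : ℕ) (G : MvPolynomial ℕ ℤ) (f : LambdaP p)
    (h : (p : LambdaP p) ^ i * f = MvPolynomial.aeval (psi p) G) :
    (p : MvPolynomial ℕ ℤ) ^ i ∣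
      MvPolynomial.aeval (fun n => (deltaFrob p)^[n] (MvPolynomial.X 0)) G := by
  refine pow_dvd_of_pow_dvd_aeval_expandDelta p i _ fun r => ?_
  rw [MvPolynomial.comp_aeval_apply]
  simp only [aeval_iterate_deltaFrob (MvPolynomial.expand p) (expandDelta p) (expand_eq_pow_add p),
    iterate_expand]
  -- For this Frobenius lift the iterates are `r(x^{p^n})`, which is the form in which `lev_dvd`
  -- gives divisibility.
  exact lev_dvd p i 1 G f h r

/-- For an element `r` of a ring without `p`-torsion and with a lift `F` of Frobenius, there is a
homomorphism `Λ_p → B` sending `ψ_{p^n}` to `F^n(r)`. -/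
theorem exists_lift_iterate (hB : IsLeftRegular (p : B)) (F : B →ₐ[ℤ] B)
    (hF : ∀ x, (p : B) ∣ F x - x ^ p) (r : B) :
    ∃ φ : LambdaP p →ₐ[ℤ] B, ∀ n, φ (psi p n) = F^[n] r := by
  choose δ hδ using hF
  have hδ' : ∀ x, F x = x ^ p + p * δ x := fun x => eq_add_of_sub_eq' (hδ x)
  have h : ∀ G : MvPolynomial ℕ ℤ, MvPolynomial.aeval (fun n => F^[n] r) G =
      MvPolynomial.aeval (fun m => δ^[m] r)
        (MvPolynomial.aeval (fun n => (deltaFrob p)^[n] (MvPolynomial.X 0)) G) := fun G => by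
    rw [MvPolynomial.comp_aeval_apply]
    simp only [aeval_iterate_deltaFrob F δ hδ']
  refine exists_lift_of_isLeftRegular p hB _ (fun i G f hf => ?_) fun G hG => ?_
  · rw [h]
    simpa using map_dvd (MvPolynomial.aeval fun m => δ^[m] r)
      (pow_dvd_aeval_iterate_deltaFrob p i G f hf)
  -- A relation `G(ψ) = 0` reads `p^i · 0 = G(ψ)` for every `i`, so the universal polynomial is
  -- divisible by all powers of `p` and vanishes.
  · rw [h, eq_zero_of_dvd p _ fun i =>
      pow_dvd_aeval_iterate_deltaFrob p i G 0 (by rw [mul_zero, hG]), map_zero]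

end LambdaP

/-! ## Deformations -/

/-- The action of the trivial plethory on a ring. -/
noncomputable def trivialAction (k : Type u) [CommRing k] (A : Type u) [CommRing A] [Algebra k A] :
    PAction k (Polynomial k) A where
  coact :=
    { toFun := fun a => ⟨Polynomial.aeval a⟩
      map_zero' := WittRing.ext <| Polynomial.algHom_ext <| by
        change _ = (trivialData k).ev PUnit.unit A 0
        rw [map_zero, Polynomial.aeval_X]
      map_one' := WittRing.ext <| Polynomial.algHom_ext <| by
        change _ = (trivialData k).ev PUnit.unit A 1
        rw [map_one, Polynomial.aeval_X]
      map_add' := fun a b => WittRing.ext <| Polynomial.algHom_ext <| by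
        refine Eq.trans ?_
          ((trivialData k).conv_coadd_psi (Polynomial.aeval a) (Polynomial.aeval b) PUnit.unit).symm
        simp [trivialData]
      map_mul' := fun a b => WittRing.ext <| Polynomial.algHom_ext <| by
        refine Eq.trans ?_
          ((trivialData k).conv_comul_psi (Polynomial.aeval a) (Polynomial.aeval b) PUnit.unit).symm
        simp [trivialData]
      commutes' := fun c => WittRing.ext <| Polynomial.algHom_ext <| by
        change _ = (trivialData k).ev PUnit.unit A (algebraMap k _ c)
        rw [AlgHom.commutes, Polynomial.aeval_X] }
  assoc α β r := by
    change Polynomial.aeval r (Polynomial.aeval β α) = Polynomial.aeval (Polynomial.aeval r β) α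
    exact (Polynomial.aeval_algHom_apply (Polynomial.aeval r) β α).symm
  unit_act r := Polynomial.aeval_X r

theorem PAction.act_X_pow {k : Type u} [CommRing k] {A : Type u} [CommRing A] [Algebra k A]
    (b : PAction k (Polynomial k) A) (n : ℕ) (a : A) : b.act (Polynomial.X ^ n) a = a ^ n := by
  have h : b.act Polynomial.X a = a := b.unit_act a
  unfold PAction.act at *
  rw [map_pow, h]

/-- An element killed by a power of `(x)` is one killed by a power of `x`, and powers of a regular
element are regular. -/
theorem torsionFreeAt_span_singleton_iff {O R : Type*} [CommRing O] [CommRing R] [Algebra O R]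
    (x : O) : TorsionFreeAt (Ideal.span {x}) R ↔ IsLeftRegular (algebraMap O R x) := by
  rw [isLeftRegular_iff_right_eq_zero_of_mul]
  constructor
  · intro h r hr
    refine h r ⟨1, fun y hy => ?_⟩
    rw [pow_one, Ideal.mem_span_singleton] at hy
    obtain ⟨c, rfl⟩ := hy
    rw [mul_comm, mul_smul, Algebra.smul_def x, hr, smul_zero]
  · rintro h r ⟨n, hn⟩
    have h1 := hn (x ^ n) (Ideal.pow_mem_pow (Ideal.mem_span_singleton_self _) n)
    rw [Algebra.smul_def, map_pow] at h1
    exact ((isLeftRegular_iff_right_eq_zero_of_mul.mpr h).pow n) (by simpa using h1)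

/-- Since `k = O/(x)`, the ring `k ⊗ R` is `R/xR`. Only the map `k ⊗ R → R/xR` is needed, built from
the factorisation `φ` of `O → R/xR` through `k`. -/
theorem one_tmul_eq_zero_iff_dvd {O k R : Type*} [CommRing O] [CommRing k] [Algebra O k]
    [CommRing R] [Algebra O R] (hk : Function.Surjective (algebraMap O k)) {x : O}
    (hx : RingHom.ker (algebraMap O k) = Ideal.span {x}) (r : R) :
    (1 : k) ⊗ₜ[O] r = 0 ↔ algebraMap O R x ∣ r := by
  constructor
  · intro h
    let I := Ideal.span {algebraMap O R x}
    let φ : k →ₐ[O] R ⧸ I :=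
      (Ideal.Quotient.liftₐ (RingHom.ker (Algebra.ofId O k)) (Algebra.ofId O (R ⧸ I)) fun a ha => by
        change a ∈ RingHom.ker (algebraMap O k) at ha
        rw [hx] at ha
        obtain ⟨c, rfl⟩ := Ideal.mem_span_singleton.mp ha
        rw [map_mul]
        refine mul_eq_zero_of_left ?_ _
        exact Ideal.Quotient.eq_zero_iff_mem.mpr (Ideal.mem_span_singleton_self _)).comp
      (Ideal.quotientKerAlgEquivOfSurjective (f := Algebra.ofId O k) hk).symm.toAlgHom
    have h1 := congrArg (Algebra.TensorProduct.productMap φ (Ideal.Quotient.mkₐ O I)) h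
    rw [Algebra.TensorProduct.productMap_apply_tmul, map_one, one_mul, map_zero] at h1
    exact Ideal.mem_span_singleton.mp (Ideal.Quotient.eq_zero_iff_mem.mp h1)
  · rintro ⟨c, rfl⟩
    have h : algebraMap O k x = 0 := by
      rw [← RingHom.mem_ker, hx]
      exact Ideal.mem_span_singleton_self _
    rw [← Algebra.smul_def, ← TensorProduct.smul_tmul, Algebra.smul_def, h, zero_mul,
      TensorProduct.zero_tmul]

/-- When `P` is generated by elements `g n` that act on the trivial plethory as `q n`-th powers, a
deformation is a torsion-free `P`-ring on which each `g n` lifts the `q n`-th power map. -/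
theorem isDeformation_trivial_iff {O k P R : Type u} [CommRing O] [CommRing k] [Algebra O k]
    [CommRing P] [Algebra O P] [Plethory O P] [CommRing R] [Algebra O R]
    (f : PlethoryHom O k P (Polynomial k)) (hk : Function.Surjective (algebraMap O k)) {x : O}
    (hx : RingHom.ker (algebraMap O k) = Ideal.span {x}) {ι : Type*} (g : ι → P)
    (hg : Algebra.adjoin O (Set.range g) = ⊤) (q : ι → ℕ)
    (hf : ∀ n, f.hom (g n) = Polynomial.X ^ q n) (a : PAction O P R) :
    IsDeformation f a ↔ IsLeftRegular (algebraMap O R x) ∧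
      ∀ (n : ι) (r : R), algebraMap O R x ∣ a.act (g n) r - r ^ q n := by
  have h1 : ∀ r s : R, (1 : k) ⊗ₜ[O] r = 1 ⊗ₜ[O] s ↔ algebraMap O R x ∣ r - s := fun r s => by
    rw [← sub_eq_zero, ← TensorProduct.tmul_sub, one_tmul_eq_zero_iff_dvd hk hx]
  unfold IsDeformation
  rw [hx, torsionFreeAt_span_singleton_iff]
  refine and_congr_right fun _ => ⟨?_, fun h => ⟨trivialAction k _, fun α r => ?_⟩⟩
  · rintro ⟨b, hb⟩ n r
    have h := hb (g n) r
    rwa [hf, b.act_X_pow, Algebra.TensorProduct.tmul_pow, one_pow, eq_comm, h1] at h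
  -- Both sides of the compatibility are ring homomorphisms in `α`, so the congruences for the
  -- generators `g n` suffice.
  · have key : ((Polynomial.aeval ((1 : k) ⊗ₜ[O] r)).restrictScalars O).comp f.hom =
        Algebra.TensorProduct.includeRight.comp (a.coact r).hom := by
      refine AlgHom.ext_of_adjoin_eq_top hg ?_
      rintro _ ⟨n, rfl⟩
      simp only [AlgHom.comp_apply, hf, AlgHom.restrictScalars_apply, map_pow,
        Polynomial.aeval_X, Algebra.TensorProduct.tmul_pow, one_pow]
      exact Eq.symm ((h1 _ _).mpr (h n r))
    exact DFunLike.congr_fun key α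

theorem isDeformation_zfToTrivial_iff (p : ℕ) [Fact p.Prime] {R : Type} [CommRing R] [Algebra ℤ R]
    (a : PAction ℤ ZF R) : IsDeformation (zfToTrivial p) a ↔
      IsLeftRegular (p : R) ∧ ∀ (n : ℕ) (r : R), (p : R) ∣ a.act (MvPolynomial.X n) r - r ^ p ^ n := by
  rw [isDeformation_trivial_iff (zfToTrivial p) ZMod.intCast_surjective (ZMod.ker_intCastRingHom p)
    MvPolynomial.X MvPolynomial.adjoin_range_X (fun n => p ^ n) (zfRed_X p)]
  simp

/-! ## Morphisms of plethories -/

/-- The map on tensor squares induced by a homomorphism, in the form used for morphisms of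
plethories. -/
abbrev tensorSquare {O P P' : Type*} [CommRing O] [CommRing P] [Algebra O P]
    [CommRing P'] [Algebra O P'] (f : P →ₐ[O] P') : P ⊗[O] P →ₐ[O] P' ⊗[O] P' :=
  Algebra.TensorProduct.productMap
    (((pt1 O P').restrictScalars O).comp f) (((pt2 O P').restrictScalars O).comp f)

theorem tensorSquare_comp {O P P' P'' : Type*} [CommRing O] [CommRing P] [Algebra O P]
    [CommRing P'] [Algebra O P'] [CommRing P''] [Algebra O P''] (g : P' →ₐ[O] P'') (f : P →ₐ[O] P') :
    (tensorSquare g).comp (tensorSquare f) = tensorSquare (g.comp f) := by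
  ext <;> simp

theorem tensorSquare_id {O P : Type*} [CommRing O] [CommRing P] [Algebra O P] :
    tensorSquare (AlgHom.id O P) = AlgHom.id O (P ⊗[O] P) := by
  ext <;> simp

section
variable {O P P' P'' : Type u} [CommRing O] [CommRing P] [Algebra O P] [Plethory O P]
  [CommRing P'] [Algebra O P'] [Plethory O P'] [CommRing P''] [Algebra O P''] [Plethory O P'']

theorem PlethoryMap.ext {i j : PlethoryMap O P P'} (h : ∀ α, i.hom α = j.hom α) : i = j := by
  obtain ⟨f, _⟩ := i
  obtain ⟨g, _⟩ := j
  obtain rfl : f = g := AlgHom.ext h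
  rfl

/-- The identity morphism of a plethory. -/
def PlethoryMap.id (O P : Type u) [CommRing O] [CommRing P] [Algebra O P] [Plethory O P] :
    PlethoryMap O P P where
  hom := AlgHom.id O P
  map_coadd _ := (DFunLike.congr_fun tensorSquare_id _).symm
  map_comul _ := (DFunLike.congr_fun tensorSquare_id _).symm
  map_colin _ _ := rfl
  map_circ _ _ := rfl
  map_unit := rfl

/-- The composition of morphisms of plethories. -/
def PlethoryMap.comp (g : PlethoryMap O P' P'') (f : PlethoryMap O P P') :
    PlethoryMap O P P'' where
  hom := g.hom.comp f.hom
  map_coadd α := by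
    rw [AlgHom.comp_apply, g.map_coadd, f.map_coadd]
    exact DFunLike.congr_fun (tensorSquare_comp g.hom f.hom) _
  map_comul α := by
    rw [AlgHom.comp_apply, g.map_comul, f.map_comul]
    exact DFunLike.congr_fun (tensorSquare_comp g.hom f.hom) _
  map_colin c α := (g.map_colin c (f.hom α)).trans (f.map_colin c α)
  map_circ α β := by
    simp only [AlgHom.comp_apply]
    rw [f.map_circ, g.map_circ]
  map_unit := by rw [AlgHom.comp_apply, f.map_unit, g.map_unit]

theorem PlethoryMap.action_act (i : PlethoryMap O P P') (α : P) (r : P') :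
    i.action.act α r = Plethory.circ O (i.hom α) r := rfl

end

theorem isLeftRegular_algebraMap_tensor {O R : Type*} [CommRing O] [IsDomain O]
    [IsPrincipalIdealRing O] [CommRing R] [Algebra O R] {x : O} (hx : Prime x)
    (hR : IsLeftRegular (algebraMap O R x)) : IsLeftRegular (algebraMap O (R ⊗[O] R) x) := by
  rw [isLeftRegular_iff_right_eq_zero_of_mul] at hR ⊢
  simp only [← Algebra.smul_def] at hR ⊢
  exact eq_zero_of_prime_smul_tensor hx hR hR

theorem isLeftRegular_natCast_tensor {O R : Type*} [CommRing O] [IsDomain O]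
    [IsPrincipalIdealRing O] [CommRing R] [Algebra O R] {p : ℕ} (hp : Prime (p : O))
    (hR : IsLeftRegular (p : R)) : IsLeftRegular (p : R ⊗[O] R) := by
  rw [← map_natCast (algebraMap O _)] at hR ⊢
  exact isLeftRegular_algebraMap_tensor hp hR

/-! ## The universal property of `Λ_p` -/

instance isScalarTower_int_int (R : Type*) [Ring R] [Algebra ℤ R] :
    @IsScalarTower ℤ ℤ R (Algebra.id ℤ).toSMul Algebra.toSMul Algebra.toSMul :=
  @IsScalarTower.left ℤ R _ Algebra.toModule.toMulAction

/-- The action of `F^{∘n}` on a `ℤ⟨F⟩`-ring, as a ring endomorphism. -/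
noncomputable def PAction.frob {R : Type} [CommRing R] [Algebra ℤ R] (a : PAction ℤ ZF R) (n : ℕ) : R →ₐ[ℤ] R :=
  (zfData.ev n R).comp a.coact

theorem PAction.frob_apply {R : Type} [CommRing R] [Algebra ℤ R] (a : PAction ℤ ZF R) (n : ℕ)
    (r : R) : a.frob n r = a.act (MvPolynomial.X n) r := rfl

theorem circ_X_X (m n : ℕ) : Plethory.circ ℤ (MvPolynomial.X m : ZF) (MvPolynomial.X n) =
    MvPolynomial.X (m + n) :=
  (zfData.comp_psi (MvPolynomial.X n) m).trans (zfData.frob_psi m n)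

/-- Since `F^{∘(1+n)} = F ∘ F^{∘n}`, the whole action is governed by the single endomorphism given
by `F`. -/
theorem PAction.act_X {R : Type} [CommRing R] [Algebra ℤ R] (a : PAction ℤ ZF R) (n : ℕ) (r : R) :
    a.act (MvPolynomial.X n) r = (a.frob 1)^[n] r := by
  induction n with
  | zero => exact a.unit_act r
  | succ n ih =>
    rw [Function.iterate_succ_apply', ← ih, add_comm, ← circ_X_X]
    exact a.assoc _ _ _

/-! ### `Λ_p` as a deformation, and its maps to other deformations -/

section
variable (p : ℕ) [hp : Fact p.Prime]

theorem dvd_expand_pow_sub_pow {σ : Type*} (n : ℕ) (g : MvPolynomial σ ℤ) :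
    (p : MvPolynomial σ ℤ) ∣ MvPolynomial.expand (p ^ n) g - g ^ p ^ n := by
  induction n with
  | zero => simp
  | succ n ih =>
    have h1 := map_dvd (MvPolynomial.expand p) ih
    have h2 := dvd_expand_sub_pow p (g ^ p ^ n)
    rw [map_natCast, map_sub, ← MvPolynomial.expand_mul] at h1
    rw [← pow_mul, ← pow_succ] at h2
    rw [pow_succ']
    convert dvd_add h1 h2 using 1
    rw [pow_succ']
    ring

/-- The congruence holds in each number of variables, and saturation (`exists_of_lev_dvd`) puts the
quotients together into an element of `Λ_p`. -/
theorem LambdaP.dvd_frob_sub_pow (n : ℕ) (f : LambdaP p) :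
    (p : LambdaP p) ∣ LambdaP.frob p n f - f ^ p ^ n := by
  obtain ⟨y, hy⟩ := LambdaP.exists_of_lev_dvd p 1 (LambdaP.frob p n f - f ^ p ^ n) fun N => by
    rw [map_sub, map_pow, LambdaP.lev_frob, pow_one]
    exact dvd_expand_pow_sub_pow p n _
  exact ⟨y, by rw [← hy, pow_one]⟩

theorem zfToLambdaP_X (n : ℕ) : (zfToLambdaP p).hom (MvPolynomial.X n) = LambdaP.psi p n :=
  MvPolynomial.aeval_X _ _

theorem LambdaP.isDeformation : IsDeformation (zfToTrivial p) (zfToLambdaP p).action := by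
  rw [isDeformation_zfToTrivial_iff]
  refine ⟨fun x y h => LambdaP.p_cancel p 1 (by simpa using h), fun n f => ?_⟩
  have h : (zfToLambdaP p).action.act (MvPolynomial.X n) f = LambdaP.frob p n f := by
    rw [PlethoryMap.action_act, zfToLambdaP_X]
    exact (LambdaP.data p).comp_psi f n
  rw [h]
  exact LambdaP.dvd_frob_sub_pow p n f

/-- With respect to `p`-torsion-free targets, `ℤ⟨F⟩ → Λ_p` behaves as an epimorphism of rings. -/
theorem LambdaP.hom_ext_of_comp_eq {P : Type*} [CommRing P] [Algebra ℤ P]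
    (hP : IsLeftRegular (p : P)) (φ χ : LambdaP p →ₐ[ℤ] P)
    (h : ∀ α, φ ((zfToLambdaP p).hom α) = χ ((zfToLambdaP p).hom α)) : φ = χ :=
  LambdaP.hom_ext_of_isLeftRegular p hP _ _ fun n => by rw [← zfToLambdaP_X, h]

variable {P : Type} [CommRing P] [Algebra ℤ P] [Plethory ℤ P] (j : PlethoryMap ℤ ZF P)

/-- A homomorphism `Λ_p → P` under `ℤ⟨F⟩` is a map of plethories, if `P` has no `p`-torsion. -/
def LambdaP.plethoryMapOfHom (hP : IsLeftRegular (p : P)) (φ : LambdaP p →ₐ[ℤ] P)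
    (hφ : ∀ α, φ ((zfToLambdaP p).hom α) = j.hom α) : PlethoryMap ℤ (LambdaP p) P where
  hom := φ
  map_coadd α := by
    refine DFunLike.congr_fun (f := (Biring.coadd ℤ).comp φ)
      (g := (tensorSquare φ).comp (Biring.coadd ℤ))
      -- As `P ⊗ P` has no `p`-torsion, it is enough to compare on the `ψ_{p^n}`, where both
      -- structure maps from `ℤ⟨F⟩` respect coaddition.
      (LambdaP.hom_ext_of_isLeftRegular p (isLeftRegular_natCast_tensor (Nat.prime_iff_prime_int.mp hp.out) hP) _ _ fun n => ?_) α
    rw [AlgHom.comp_apply, AlgHom.comp_apply, ← zfToLambdaP_X, hφ, j.map_coadd,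
      (zfToLambdaP p).map_coadd]
    have h : (tensorSquare φ).comp (tensorSquare (zfToLambdaP p).hom) = tensorSquare j.hom := by
      rw [tensorSquare_comp]
      exact congrArg tensorSquare (AlgHom.ext hφ)
    exact (DFunLike.congr_fun h _).symm
  map_comul α := by
    refine DFunLike.congr_fun (f := (Biring.comul ℤ).comp φ)
      (g := (tensorSquare φ).comp (Biring.comul ℤ))
      (LambdaP.hom_ext_of_isLeftRegular p (isLeftRegular_natCast_tensor (Nat.prime_iff_prime_int.mp hp.out) hP) _ _ fun n => ?_) α
    rw [AlgHom.comp_apply, AlgHom.comp_apply, ← zfToLambdaP_X, hφ, j.map_comul,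
      (zfToLambdaP p).map_comul]
    have h : (tensorSquare φ).comp (tensorSquare (zfToLambdaP p).hom) = tensorSquare j.hom := by
      rw [tensorSquare_comp]
      exact congrArg tensorSquare (AlgHom.ext hφ)
    exact (DFunLike.congr_fun h _).symm
  map_colin c α := by
    refine DFunLike.congr_fun (f := (Biring.colin c).comp φ) (g := Biring.colin c)
      (LambdaP.hom_ext p _ _ fun n => ?_) α
    rw [AlgHom.comp_apply, ← zfToLambdaP_X, hφ]
    exact (j.map_colin c _).trans ((zfToLambdaP p).map_colin c _).symm
  map_circ α β := by
    -- Composition is a ring homomorphism only in its left argument, except that `F^{∘n} ∘ -` is one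
    -- too because `F^{∘n}` is ring-like. So the case `α = ψ_{p^n}` is settled first, by comparing
    -- on `β = ψ_{p^m}`; general `α` follows for fixed `β`.
    have h : ∀ n, φ.comp ((zfToLambdaP p).action.frob n) = (j.action.frob n).comp φ := fun n =>
      LambdaP.hom_ext_of_isLeftRegular p hP _ _ fun m => by
        simp only [AlgHom.comp_apply, PAction.frob_apply, PlethoryMap.action_act]
        rw [← zfToLambdaP_X, ← (zfToLambdaP p).map_circ, hφ, hφ, j.map_circ]
    refine DFunLike.congr_fun (f := φ.comp (Plethory.comp (k := ℤ) β).hom)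
      (g := (Plethory.comp (k := ℤ) (φ β)).hom.comp φ)
      (LambdaP.hom_ext_of_isLeftRegular p hP _ _ fun n => ?_) α
    rw [AlgHom.comp_apply, AlgHom.comp_apply, ← zfToLambdaP_X, hφ]
    exact DFunLike.congr_fun (h n) β
  map_unit := by rw [← (zfToLambdaP p).map_unit, hφ, j.map_unit]

theorem LambdaP.exists_hom_of_isDeformation (hj : IsDeformation (zfToTrivial p) j.action) :
    ∃ φ : LambdaP p →ₐ[ℤ] P, ∀ α, φ ((zfToLambdaP p).hom α) = j.hom α := by
  obtain ⟨hP, hF⟩ := (isDeformation_zfToTrivial_iff p _).mp hj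
  -- The element to lift at is the unit `e` of `P`, since `F^n(e) = j(F^{∘n}) ∘ e = j(F^{∘n})`.
  obtain ⟨φ, hφ⟩ := LambdaP.exists_lift_iterate p hP (j.action.frob 1)
    (fun x => by simpa [PAction.frob_apply] using hF 1 x) (Plethory.unit ℤ)
  refine ⟨φ, fun α => ?_⟩
  refine DFunLike.congr_fun (f := φ.comp (zfToLambdaP p).hom) (g := j.hom)
    (MvPolynomial.algHom_ext fun n => ?_) α
  rw [AlgHom.comp_apply, zfToLambdaP_X, hφ, ← PAction.act_X]
  exact Plethory.comp_unit _

theorem LambdaP.isAmplification : IsAmplification (zfToTrivial p) (zfToLambdaP p) where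
  deformation := LambdaP.isDeformation p
  initial P _ _ _ j hj := by
    have hP := ((isDeformation_zfToTrivial_iff p _).mp hj).1
    obtain ⟨φ, hφ⟩ := LambdaP.exists_hom_of_isDeformation p j hj
    refine ⟨LambdaP.plethoryMapOfHom p j hP φ hφ, hφ, fun g hg => PlethoryMap.ext ?_⟩
    exact DFunLike.congr_fun (LambdaP.hom_ext_of_comp_eq p hP g.hom φ fun α =>
      (hg α).trans (hφ α).symm)

end

/-- An initial object is unique up to isomorphism: maps in both directions are inverse. -/
theorem IsAmplification.leftInverse {O k P Q P' P'' : Type u} [CommRing O] [CommRing k]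
    [Algebra O k] [CommRing P] [Algebra O P] [Plethory O P] [CommRing Q] [Algebra k Q]
    [Algebra O Q] [IsScalarTower O k Q] [Plethory k Q] {f : PlethoryHom O k P Q}
    [CommRing P'] [Algebra O P'] [Plethory O P'] [CommRing P''] [Algebra O P''] [Plethory O P'']
    {i : PlethoryMap O P P'} {j : PlethoryMap O P P''} (hi : IsAmplification f i)
    (g : PlethoryMap O P' P'') (hg : ∀ α, g.hom (i.hom α) = j.hom α)
    (h : PlethoryMap O P'' P') (hh : ∀ α, h.hom (j.hom α) = i.hom α) :
    Function.LeftInverse h.hom g.hom := fun x => by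
  have key := (hi.initial P' i hi.deformation).unique
    (y₁ := h.comp g) (y₂ := PlethoryMap.id O P')
    (fun α => by
      change h.hom (g.hom (i.hom α)) = _
      rw [hg, hh]) (fun _ => rfl)
  exact congrArg (fun q : PlethoryMap O P' P' => q.hom x) key

/-! ### The comparison of `Λ_p` with an arbitrary amplification -/

theorem mainTheorem5 (p : ℕ) [Fact p.Prime] :
    (∃ (P' : Type) (_ : CommRing P') (_ : Algebra ℤ P') (_ : Plethory ℤ P')
      (i : PlethoryMap ℤ ZF P'), IsAmplification (zfToTrivial p) i) ∧
    ∀ (P' : Type) [CommRing P'] [Algebra ℤ P'] [Plethory ℤ P'] (i : PlethoryMap ℤ ZF P'),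
      IsAmplification (zfToTrivial p) i →
        (∃! χ : LambdaP p →ₐ[ℤ] P',
          IsPRingHom (zfToLambdaP p).action i.action χ ∧
            ∀ α : ZF, χ ((zfToLambdaP p).toAlgHom α) = i.toAlgHom α) ∧
        ∀ χ : LambdaP p →ₐ[ℤ] P',
          IsPRingHom (zfToLambdaP p).action i.action χ →
          (∀ α : ZF, χ ((zfToLambdaP p).toAlgHom α) = i.toAlgHom α) →
            Function.Bijective χ ∧ ∃ φ : PlethoryMap ℤ (LambdaP p) P', φ.toAlgHom = χ := by
  refine ⟨⟨LambdaP p, _, _, _, zfToLambdaP p, LambdaP.isAmplification p⟩, ?_⟩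
  intro P' _ _ _ i hi
  have hP := ((isDeformation_zfToTrivial_iff p _).mp hi.deformation).1
  refine ⟨?_, fun χ _ hχ => ?_⟩
  · obtain ⟨φ, hφ⟩ := LambdaP.exists_hom_of_isDeformation p i hi.deformation
    refine ⟨φ, ⟨fun α r => ?_, hφ⟩, fun χ hχ => LambdaP.hom_ext_of_comp_eq p hP χ φ fun α =>
      (hχ.2 α).trans (hφ α).symm⟩
    -- The action of `α` is composition with its image in the plethory, so equivariance is an
    -- instance of compatibility with `∘`.
    rw [PlethoryMap.action_act, PlethoryMap.action_act, ← hφ]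
    exact (LambdaP.plethoryMapOfHom p i hP φ hφ).map_circ _ _
  · let g := LambdaP.plethoryMapOfHom p i hP χ hχ
    -- The inverse comes from initiality of `P'`, as `Λ_p` is itself a deformation. Initiality of
    -- `Λ_p` gives injectivity and that of `P'` gives surjectivity.
    obtain ⟨h, hh, -⟩ := hi.initial (LambdaP p) (zfToLambdaP p) (LambdaP.isDeformation p)
    exact ⟨⟨((LambdaP.isAmplification p).leftInverse g hχ h hh).injective,
      (hi.leftInverse h hh g hχ).surjective⟩, g, rfl⟩
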